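/- Let $(\Omega,\mathcal F,\mathbb P)$ be a probability space and let $f:\mathbb R^d\to\mathbb R$ be a differentiable function that is bounded from below and whose gradient $\nabla f$ is Lipschitz continuous with some constant $L>0$. Put $\mathrm{crit}(f)=\{x\in\mathbb R^d:\nabla f(x)=0\}$ and suppose that $f$ satisfies the Łojasiewicz inequality at every critical point: for every $x^*\in\mathrm{crit}(f)$ there are $\eta\in(0,\infty]$, a neighborhood $U$ of $x^*$, a constant $C>0$ and an exponent $\theta\in[\tfrac12,1)$ (all of which may depend on $x^*$) such that $$\|\nabla f(x)\|\ge C\,|f(x)-f(x^*)|^{\theta}\quad\text{for all } x\in U \text{ with } 0<|f(x)-f(x^*)|<\eta .$$ Let $\lambda\in[0,1)$, $\nu\ge 0$, and let $(\alpha_k)_{k\ge1}$ be a non-increasing sequence of positive real numbers with $$\sum_{k=1}^\infty\alpha_k=\infty\quad\text{and}\quad \sum_{k=1}^\infty\alpha_k^2\Big(\sum_{i=1}^k\alpha_i\Big)^{2r}<\infty\quad\text{for some } r>\tfrac12 .$$ Let $x^0\in\mathbb R^d$ be deterministic, $x^1=x^0$, and let the random vectors $x^k:\Omega\to\mathbb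 R^d$ be generated by the stochastic gradient method with momentum, $$x^{k+1}=x^k-\alpha_k\big(\nabla f(x^k+\nu(x^k-x^{k-1}))-e^k\big)+\lambda(x^k-x^{k-1}),\qquad k\ge 1,$$ where, with $\mathcal F_k=\sigma(x^0,\dots,x^k)$ and some constant $\sigma$, the random errors $e^k:\Omega\to\mathbb R^d$ satisfy $\mathbb E[e^k\mid\mathcal F_k]=0$ and $\mathbb E[\|e^k\|^2\mid\mathcal F_k]\le\sigma^2$ almost surely for all $k\ge1$. Then, with probability one, either $\lim_{k\to\infty}\|x^k\|=\infty$ or $(x^k)_k$ converges to some (random) point of $\mathrm{crit}(f)$. (No a priori boundedness of the iterates is assumed.) -/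

import Mathlib

open MeasureTheory ProbabilityTheory Filter Topology
open scoped NNReal Gradient

/-- The set `crit f` of critical (stationary) points of `f`. -/
def critSet {d : ℕ} (f : EuclideanSpace ℝ (Fin d) → ℝ) : Set (EuclideanSpace ℝ (Fin d)) :=
  {x | ∇ f x = 0}

/-- `f` is differentiable and bounded from below, and its gradient is Lipschitz continuous with
some parameter `L > 0`. -/
structure SmoothBoundedBelow {d : ℕ} (f : EuclideanSpace ℝ (Fin d) → ℝ) : Prop where
  differentiable : Differentiable ℝ f
  bddBelow : ∃ fbar : ℝ, ∀ x, fbar ≤ f x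
  lipschitz : ∃ L : ℝ≥0, 0 < L ∧ LipschitzWith L (∇ f)

/-- The Łojasiewicz inequality at `xs`, with `η ∈ (0, ∞]`, a neighborhood `U` of `xs`, a constant
`C > 0` and an exponent `θ ∈ [1/2, 1)`, all of which may depend on `xs`. -/
def LojasiewiczAt {d : ℕ} (f : EuclideanSpace ℝ (Fin d) → ℝ)
    (xs : EuclideanSpace ℝ (Fin d)) : Prop :=
  ∃ η : EReal, 0 < η ∧ ∃ U ∈ 𝓝 xs, ∃ C : ℝ, 0 < C ∧ ∃ θ : ℝ, 1 / 2 ≤ θ ∧ θ < 1 ∧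
    ∀ x ∈ U, 0 < |f x - f xs| → ((|f x - f xs| : ℝ) : EReal) < η →
      C * |f x - f xs| ^ θ ≤ ‖∇ f x‖

/-- The process `x` is generated by stochastic gradient descent with momentum, with deterministic
initial points `x 0 = x 1 = x₀`, step sizes `α`, momentum parameters `lam`, `ν` and stochastic
errors `e`. Only `α k` and `e k` with `1 ≤ k` enter. -/
structure IsSGDM {d : ℕ} {Ω : Type*} (f : EuclideanSpace ℝ (Fin d) → ℝ) (α : ℕ → ℝ) (lam ν : ℝ)
    (x₀ : EuclideanSpace ℝ (Fin d)) (e x : ℕ → Ω → EuclideanSpace ℝ (Fin d)) : Prop where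
  init_zero : ∀ ω, x 0 ω = x₀
  init_one : ∀ ω, x 1 ω = x₀
  step : ∀ k, 1 ≤ k → ∀ ω,
    x (k + 1) ω = x k ω
      - α k • (∇ f (x k ω + ν • (x k ω - x (k - 1) ω)) - e k ω)
      + lam • (x k ω - x (k - 1) ω)

/-- With respect to the natural filtration `F k = σ(x 0, …, x k)`, the errors have conditional mean
zero and conditional second moment at most `σ ^ 2`. Square integrability is a consequence of the
latter bound; it is spelled out because `condExp` is `0` on functions that are not integrable. -/
structure NoiseAssumption {d : ℕ} {Ω : Type*} [MeasurableSpace Ω] (μ : Measure Ω)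
    (x : ℕ → Ω → EuclideanSpace ℝ (Fin d)) (hx : ∀ k, StronglyMeasurable (x k))
    (e : ℕ → Ω → EuclideanSpace ℝ (Fin d)) (σ : ℝ) : Prop where
  memLp : ∀ k, 1 ≤ k → MemLp (e k) 2 μ
  condMean : ∀ k, 1 ≤ k → μ[e k | Filtration.natural x hx k] =ᵐ[μ] 0
  condVar : ∀ k, 1 ≤ k →
    μ[fun ω => ‖e k ω‖ ^ 2 | Filtration.natural x hx k] ≤ᵐ[μ] fun _ => σ ^ 2

/-!
Along `z k = x k + lam / (1 - lam) • (x k - x (k - 1))` the momentum method becomes a gradient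
method with step size `α k / (1 - lam)`, up to errors controlled by the velocity `x k - x (k - 1)`
and the noise. The norms of the single noise terms need not be summable. The steps are therefore
grouped into blocks of total step size about `τ`: within a block only the partial sums of
`α k • e k` matter, and by Doob's `L²` inequality the largest of them has second moment of the order
of `∑ α k ^ 2` over the block. As the sum of the first step sizes grows at least linearly in the
block number `j`, the step size condition makes the block errors `s j` satisfy
`∑ (j + 1) ^ (2 * r) * s j ^ 2 < ∞` almost surely.

The rest is deterministic. For small `τ`, the function value at `z`, plus a multiple of the squared
velocity, plus the tail `∑ i ≥ j, C * s i ^ 2` decreases along the block endpoints by at least a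
multiple of `‖∇ f (z j)‖ ^ 2` plus the squared velocity. If the endpoints do not escape to infinity,
they have a cluster point, which is critical. The Łojasiewicz inequality there, with the exponent
raised so that `1 / (2 * r) < θ` and hence the `θ`-th powers of the error tails are summable, shows
that the path has finite length once it is close to the cluster point, so that it converges.
-/

section Series

theorem tsum_nat_add_eq_add_tsum_nat_add_succ {v : ℕ → ℝ} (hv : Summable v) (j : ℕ) :
    ∑' i, v (i + j) = v j + ∑' i, v (i + (j + 1)) := by
  rw [((summable_nat_add_iff j).2 hv).tsum_eq_zero_add]
  simp only [zero_add, add_assoc, add_comm 1 j]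

theorem summable_nat_add_one_rpow_neg {p : ℝ} (hp : 1 < p) :
    Summable fun j : ℕ => ((j : ℝ) + 1) ^ (-p) := by
  simpa using (summable_nat_add_iff 1).2 (Real.summable_nat_rpow.2 (by linarith : -p < -1))

theorem summable_of_summable_rpow_mul {p : ℝ} (hp : 0 ≤ p) {v : ℕ → ℝ} (hv : ∀ j, 0 ≤ v j)
    (hsum : Summable fun j : ℕ => ((j : ℝ) + 1) ^ p * v j) : Summable v :=
  hsum.of_nonneg_of_le hv fun j =>
    le_mul_of_one_le_left (hv j) (Real.one_le_rpow (by simp) hp)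

theorem tsum_nat_add_le_rpow_mul_tsum {p : ℝ} (hp : 0 ≤ p) {v : ℕ → ℝ} (hv : ∀ j, 0 ≤ v j)
    (hsum : Summable fun j : ℕ => ((j : ℝ) + 1) ^ p * v j) (j : ℕ) :
    ∑' i, v (i + j) ≤ ((j : ℝ) + 1) ^ (-p) * ∑' i : ℕ, ((i : ℝ) + 1) ^ p * v i := by
  have hpos : (0 : ℝ) < (j : ℝ) + 1 := by positivity
  have hterm (i : ℕ) :
      v (i + j) ≤ ((j : ℝ) + 1) ^ (-p) * ((((i + j : ℕ) : ℝ) + 1) ^ p * v (i + j)) := by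
    rw [← mul_assoc, Real.rpow_neg hpos.le, inv_mul_eq_div]
    refine le_mul_of_one_le_left (hv _) ((one_le_div (by positivity)).2 ?_)
    gcongr
    exact le_add_self
  have hshift := (summable_nat_add_iff j).2 hsum
  calc ∑' i, v (i + j)
      ≤ ∑' i, ((j : ℝ) + 1) ^ (-p) * ((((i + j : ℕ) : ℝ) + 1) ^ p * v (i + j)) :=
        ((summable_nat_add_iff j).2 (summable_of_summable_rpow_mul hp hv hsum)).tsum_le_tsum
          hterm (hshift.mul_left _)
    _ = ((j : ℝ) + 1) ^ (-p) * ∑' i, (((i + j : ℕ) : ℝ) + 1) ^ p * v (i + j) := tsum_mul_left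
    _ ≤ ((j : ℝ) + 1) ^ (-p) * ∑' i : ℕ, ((i : ℝ) + 1) ^ p * v i := by
        refine mul_le_mul_of_nonneg_left ?_ (by positivity)
        rw [← hsum.sum_add_tsum_nat_add j]
        exact le_add_of_nonneg_left
          (Finset.sum_nonneg fun i _ => mul_nonneg (by positivity) (hv i))

theorem summable_tsum_nat_add_rpow {p θ : ℝ} (hθ : 0 ≤ θ) (hp : 0 ≤ p) (hpθ : 1 < p * θ)
    {v : ℕ → ℝ} (hv : ∀ j, 0 ≤ v j) (hsum : Summable fun j : ℕ => ((j : ℝ) + 1) ^ p * v j) :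
    Summable fun j => (∑' i, v (i + j)) ^ θ := by
  set S := ∑' i : ℕ, ((i : ℝ) + 1) ^ p * v i
  have hS : 0 ≤ S := tsum_nonneg fun i => mul_nonneg (by positivity) (hv i)
  have htail (j : ℕ) : 0 ≤ ∑' i, v (i + j) := tsum_nonneg fun i => hv _
  refine ((summable_nat_add_one_rpow_neg hpθ).mul_right (S ^ θ)).of_nonneg_of_le
    (fun j => Real.rpow_nonneg (htail j) _) fun j => ?_
  calc (∑' i, v (i + j)) ^ θ ≤ (((j : ℝ) + 1) ^ (-p) * S) ^ θ :=
        Real.rpow_le_rpow (htail j) (tsum_nat_add_le_rpow_mul_tsum hp hv hsum j) hθ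
    _ = ((j : ℝ) + 1) ^ (-(p * θ)) * S ^ θ := by
        rw [Real.mul_rpow (by positivity) hS, ← Real.rpow_mul (by positivity), neg_mul]

theorem summable_of_summable_rpow_mul_sq {p : ℝ} (hp : 1 < p) {s : ℕ → ℝ} (hs : ∀ j, 0 ≤ s j)
    (hsum : Summable fun j : ℕ => ((j : ℝ) + 1) ^ p * s j ^ 2) : Summable s := by
  refine (hsum.add (summable_nat_add_one_rpow_neg hp)).of_nonneg_of_le hs fun j => ?_
  have hpos : (0 : ℝ) < ((j : ℝ) + 1) ^ p := by positivity
  rw [Real.rpow_neg (by positivity)]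
  set A := ((j : ℝ) + 1) ^ p
  have hsquare : A * s j ^ 2 + A⁻¹ - 2 * s j = A⁻¹ * (A * s j - 1) ^ 2 := by
    field_simp
    ring
  have hsquare_nonneg : 0 ≤ A⁻¹ * (A * s j - 1) ^ 2 := by positivity
  linarith [hs j]

theorem summable_of_le_sub_succ {E a : ℕ → ℝ} (ha : ∀ j, 0 ≤ a j) {B : ℝ}
    (hB : ∀ j, B ≤ E j) (h : ∀ j, a j ≤ E j - E (j + 1)) : Summable a :=
  summable_of_sum_range_le (c := E 0 - B) ha fun n =>
    calc ∑ i ∈ Finset.range n, a i ≤ ∑ i ∈ Finset.range n, (E i - E (i + 1)) :=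
          Finset.sum_le_sum fun i _ => h i
      _ = E 0 - E n := Finset.sum_range_sub' E n
      _ ≤ E 0 - B := by linarith [hB n]

end Series

section ClusterPoint

theorem exists_mapClusterPt_of_not_tendsto_norm {E : Type*} [SeminormedAddGroup E] [ProperSpace E]
    {Z : ℕ → E} (h : ¬ Tendsto (fun j => ‖Z j‖) atTop atTop) : ∃ z, MapClusterPt z atTop Z := by
  obtain ⟨b, hb⟩ : ∃ b, ∃ᶠ j in atTop, ‖Z j‖ < b := by
    simpa only [tendsto_atTop, not_forall, not_eventually, not_le] using h
  obtain ⟨z, -, hz⟩ := (isCompact_closedBall (0 : E) b).exists_mapClusterPt_of_frequently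
    (hb.mono fun j hj => by simpa using hj.le)
  exact ⟨z, hz⟩

variable {X : Type*} [PseudoMetricSpace X] {Z : ℕ → X} {z : X} {Φ w : ℕ → ℝ}

theorem tendsto_of_dist_le_sub_of_mapClusterPt (hΦ0 : ∀ j, 0 ≤ Φ j)
    (hΦ : Tendsto Φ atTop (𝓝 0)) (hz : MapClusterPt z atTop Z)
    (hstep : ∃ U ∈ 𝓝 z, ∀ᶠ j in atTop, Z j ∈ U → dist (Z (j + 1)) (Z j) ≤ Φ j - Φ (j + 1)) :
    Tendsto Z atTop (𝓝 z) := by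
  obtain ⟨U, hU, hev⟩ := hstep
  obtain ⟨ρ, hρ, hρU⟩ := Metric.mem_nhds_iff.1 hU
  obtain ⟨J₀, hJ₀⟩ := eventually_atTop.1 hev
  rw [Metric.tendsto_atTop]
  intro ε hε
  have hερ : 0 < min ε ρ / 2 := half_pos (lt_min hε hρ)
  obtain ⟨J, hJz, hJΦ, hJ⟩ :=
    ((mapClusterPt_iff_frequently.1 hz _ (Metric.ball_mem_nhds _ hερ)).and_eventually
      ((hΦ.eventually_lt_const hερ).and (eventually_ge_atTop J₀))).exists
  rw [Metric.mem_ball] at hJz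
  have htrapped : ∀ j, J ≤ j → dist (Z j) z + Φ j ≤ dist (Z J) z + Φ J := by
    intro j hj
    induction j, hj using Nat.le_induction with
    | base => exact le_rfl
    | succ j hj ih =>
      have hmem : dist (Z j) z < ρ := by linarith [hΦ0 j, min_le_right ε ρ]
      linarith [hJ₀ j (hJ.trans hj) (hρU hmem), dist_triangle (Z (j + 1)) (Z j) z]
  exact ⟨J, fun j hj => by linarith [htrapped j hj, hΦ0 j, min_le_left ε ρ]⟩

theorem tendsto_of_dist_le_sub_add_of_mapClusterPt (hΦ0 : ∀ j, 0 ≤ Φ j)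
    (hΦ : Tendsto Φ atTop (𝓝 0)) (hw0 : ∀ j, 0 ≤ w j) (hw : Summable w)
    (hz : MapClusterPt z atTop Z)
    (hstep : ∃ U ∈ 𝓝 z, ∀ᶠ j in atTop, Z j ∈ U →
      dist (Z (j + 1)) (Z j) ≤ Φ j - Φ (j + 1) + w j) :
    Tendsto Z atTop (𝓝 z) := by
  obtain ⟨U, hU, hev⟩ := hstep
  refine tendsto_of_dist_le_sub_of_mapClusterPt (Φ := fun j => Φ j + ∑' i, w (i + j))
    (fun j => add_nonneg (hΦ0 j) (tsum_nonneg fun i => hw0 _))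
    (by simpa using hΦ.add (tendsto_sum_nat_add w)) hz ⟨U, hU, hev.mono fun j hj hjU => ?_⟩
  linarith [hj hjU, tsum_nat_add_eq_add_tsum_nat_add_succ hw j]

end ClusterPoint

section Lojasiewicz

variable {E : Type*} [NormedAddCommGroup E] [InnerProductSpace ℝ E] [CompleteSpace E]

/-- The Łojasiewicz inequality for `f` at `z` with exponent `θ`, in asymptotic form:
`|f x - f z| ^ θ` is bounded by a multiple of `‖∇ f x‖` for `x` near `z`. -/
def HasLojasiewiczExponent (f : E → ℝ) (z : E) (θ : ℝ) : Prop :=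
  (fun x => |f x - f z| ^ θ) =O[𝓝 z] ∇ f

theorem HasLojasiewiczExponent.mono {f : E → ℝ} {z : E} {θ θ' : ℝ}
    (h : HasLojasiewiczExponent f z θ) (hf : ContinuousAt f z) (hle : θ ≤ θ') (hpos : 0 < θ') :
    HasLojasiewiczExponent f z θ' := by
  refine Asymptotics.IsBigO.trans (Asymptotics.IsBigO.of_bound' ?_) h
  have hlim : Tendsto (fun x => |f x - f z|) (𝓝 z) (𝓝 0) := by
    simpa using (tendsto_sub_nhds_zero_iff.2 hf.tendsto).abs
  filter_upwards [hlim.eventually_lt_const one_pos] with x hx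
  rw [Real.norm_of_nonneg (by positivity), Real.norm_of_nonneg (by positivity)]
  rcases (abs_nonneg (f x - f z)).eq_or_lt with h0 | h0
  · rw [← h0, Real.zero_rpow hpos.ne']
    exact Real.rpow_nonneg le_rfl _
  · exact Real.rpow_le_rpow_of_exponent_ge h0 hx.le hle

theorem LojasiewiczAt.exists_hasLojasiewiczExponent {d : ℕ} {f : EuclideanSpace ℝ (Fin d) → ℝ}
    {z : EuclideanSpace ℝ (Fin d)} (h : LojasiewiczAt f z) (hf : ContinuousAt f z) :
    ∃ θ < 1, HasLojasiewiczExponent f z θ := by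
  obtain ⟨η, hη, U, hU, C, hC, θ, hθ, hθ1, hineq⟩ := h
  refine ⟨θ, hθ1, Asymptotics.IsBigO.of_bound C⁻¹ ?_⟩
  have hlim : Tendsto (fun x => ((|f x - f z| : ℝ) : EReal)) (𝓝 z) (𝓝 0) := by
    refine (continuous_coe_real_ereal.tendsto 0).comp ?_
    simpa using (tendsto_sub_nhds_zero_iff.2 hf.tendsto).abs
  filter_upwards [hlim.eventually_lt_const hη, hU] with x hxη hxU
  rw [Real.norm_of_nonneg (by positivity), le_inv_mul_iff₀ hC]
  rcases (abs_nonneg (f x - f z)).eq_or_lt with h0 | h0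
  · simp [← h0, Real.zero_rpow (by linarith : θ ≠ 0)]
  · exact hineq x hxU h0 hxη

theorem one_sub_mul_sub_le_rpow_mul_sub {θ e e' : ℝ} (hθ0 : 0 ≤ θ) (hθ1 : θ ≤ 1) (he : 0 ≤ e)
    (he' : 0 ≤ e') : (1 - θ) * (e - e') ≤ e ^ θ * (e ^ (1 - θ) - e' ^ (1 - θ)) := by
  have hθ : 0 ≤ 1 - θ := sub_nonneg.2 hθ1
  have hsplit : e ^ θ * e ^ (1 - θ) = e := by
    rw [← Real.rpow_add_of_nonneg he hθ0 hθ, add_sub_cancel, Real.rpow_one]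
  have hamgm := Real.geom_mean_le_arith_mean2_weighted hθ0 hθ he he' (by ring)
  rw [mul_sub (e ^ θ), hsplit]
  linarith

theorem le_rpow_sub_rpow_add_of_decrease {θ a b c C e e' : ℝ} (hθ0 : 0 ≤ θ) (hθ1 : θ < 1)
    (hb : 0 ≤ b) (hc : 0 < c) (hC : 0 ≤ C) (he : 0 ≤ e) (he' : 0 ≤ e')
    (hdec : c * a ^ 2 ≤ e - e') (hloj : e ^ θ ≤ C * (a + b)) :
    a ≤ 2 * C / (c * (1 - θ)) * (e ^ (1 - θ) - e' ^ (1 - θ)) + b := by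
  have hθ : 0 < 1 - θ := by linarith
  have hle : e' ≤ e := by nlinarith [sq_nonneg a]
  have hΔ : 0 ≤ e ^ (1 - θ) - e' ^ (1 - θ) := sub_nonneg.2 (Real.rpow_le_rpow he' hle hθ.le)
  rcases le_or_gt a b with hab | hab
  · exact hab.trans (le_add_of_nonneg_left (by positivity))
  · have hquad : a * (c * (1 - θ) * a) ≤ a * (2 * C * (e ^ (1 - θ) - e' ^ (1 - θ))) :=
      calc a * (c * (1 - θ) * a) = (1 - θ) * (c * a ^ 2) := by ring
        _ ≤ (1 - θ) * (e - e') := by gcongr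
        _ ≤ e ^ θ * (e ^ (1 - θ) - e' ^ (1 - θ)) :=
            one_sub_mul_sub_le_rpow_mul_sub hθ0 hθ1.le he he'
        _ ≤ C * (a + a) * (e ^ (1 - θ) - e' ^ (1 - θ)) := by
            gcongr
            exact hloj.trans (by gcongr)
        _ = a * (2 * C * (e ^ (1 - θ) - e' ^ (1 - θ))) := by ring
    have hlin := le_of_mul_le_mul_left hquad (hb.trans_lt hab)
    calc a ≤ 2 * C / (c * (1 - θ)) * (e ^ (1 - θ) - e' ^ (1 - θ)) := by
          rw [div_mul_eq_mul_div, le_div_iff₀ (by positivity)]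
          linarith
      _ ≤ _ := le_add_of_nonneg_right hb

end Lojasiewicz

section InexactDescent

variable {E : Type*} [NormedAddCommGroup E] [InnerProductSpace ℝ E] [CompleteSpace E]

/-- `Z` approximately follows the negative gradient flow of `f`: up to the errors `s`, which are
square summable against the weights `(j + 1) ^ p`, it decreases the Lyapunov function
`f (Z j) + D j ^ 2`, where `D j` stands for the momentum carried by the method. -/
structure IsInexactDescent (f : E → ℝ) (p c C : ℝ) (Z : ℕ → E) (D s : ℕ → ℝ) : Prop where
  one_lt_exponent : 1 < p
  rate_pos : 0 < c
  const_pos : 0 < C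
  momentum_nonneg : ∀ j, 0 ≤ D j
  error_nonneg : ∀ j, 0 ≤ s j
  summable_error : Summable fun j : ℕ => ((j : ℝ) + 1) ^ p * s j ^ 2
  decrease : ∀ j, f (Z (j + 1)) + D (j + 1) ^ 2 ≤
    f (Z j) + D j ^ 2 - c * (‖∇ f (Z j)‖ ^ 2 + D j ^ 2) + C * s j ^ 2
  norm_sub_le : ∀ j, ‖Z (j + 1) - Z j‖ ≤ C * (‖∇ f (Z j)‖ + D j + s j)

namespace IsInexactDescent

/-- The total error that is still to come from index `j` on. -/
noncomputable def errorTail (C : ℝ) (s : ℕ → ℝ) (j : ℕ) : ℝ :=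
  ∑' i, C * s (i + j) ^ 2

/-- The Lyapunov function increased by the errors still to come, which makes it decreasing. -/
noncomputable def energy (f : E → ℝ) (C : ℝ) (Z : ℕ → E) (D s : ℕ → ℝ) (j : ℕ) : ℝ :=
  f (Z j) + D j ^ 2 + errorTail C s j

variable {f : E → ℝ} {p c C : ℝ} {Z : ℕ → E} {D s : ℕ → ℝ}

theorem summable_weighted_error (h : IsInexactDescent f p c C Z D s) :
    Summable fun j : ℕ => ((j : ℝ) + 1) ^ p * (C * s j ^ 2) :=
  (h.summable_error.mul_left C).congr fun _ => mul_left_comm _ _ _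

theorem error_sq_nonneg (h : IsInexactDescent f p c C Z D s) (j : ℕ) : 0 ≤ C * s j ^ 2 :=
  mul_nonneg h.const_pos.le (sq_nonneg _)

theorem errorTail_nonneg (h : IsInexactDescent f p c C Z D s) (j : ℕ) : 0 ≤ errorTail C s j :=
  tsum_nonneg fun _ => h.error_sq_nonneg _

theorem errorTail_eq_add_errorTail_succ (h : IsInexactDescent f p c C Z D s) (j : ℕ) :
    errorTail C s j = C * s j ^ 2 + errorTail C s (j + 1) :=
  tsum_nat_add_eq_add_tsum_nat_add_succ
    (summable_of_summable_rpow_mul (zero_le_one.trans h.one_lt_exponent.le) h.error_sq_nonneg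
      h.summable_weighted_error) j

theorem summable_errorTail_rpow (h : IsInexactDescent f p c C Z D s) {θ : ℝ} (hθ : 1 / p < θ) :
    Summable fun j => errorTail C s j ^ θ := by
  have hp : 0 < p := zero_lt_one.trans h.one_lt_exponent
  exact summable_tsum_nat_add_rpow (v := fun j => C * s j ^ 2)
    ((by positivity : 0 ≤ 1 / p).trans hθ.le) hp.le
    ((div_lt_iff₀' hp).1 hθ) h.error_sq_nonneg h.summable_weighted_error

theorem summable_error_self (h : IsInexactDescent f p c C Z D s) : Summable s :=
  summable_of_summable_rpow_mul_sq h.one_lt_exponent h.error_nonneg h.summable_error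

theorem mul_sq_le_energy_sub_energy_succ (h : IsInexactDescent f p c C Z D s) (j : ℕ) :
    c * (‖∇ f (Z j)‖ ^ 2 + D j ^ 2) ≤ energy f C Z D s j - energy f C Z D s (j + 1) := by
  simp only [energy, h.errorTail_eq_add_errorTail_succ j]
  linarith [h.decrease j]

theorem energy_antitone (h : IsInexactDescent f p c C Z D s) : Antitone (energy f C Z D s) :=
  antitone_nat_of_succ_le fun j => sub_nonneg.1
    ((mul_nonneg h.rate_pos.le (by positivity)).trans (h.mul_sq_le_energy_sub_energy_succ j))

theorem le_energy (h : IsInexactDescent f p c C Z D s) (j : ℕ) : f (Z j) ≤ energy f C Z D s j := by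
  have := h.errorTail_nonneg j
  unfold energy
  nlinarith [sq_nonneg (D j)]

theorem tendsto_sq_add_sq (h : IsInexactDescent f p c C Z D s) (hf : ∃ B, ∀ x, B ≤ f x) :
    Tendsto (fun j => ‖∇ f (Z j)‖ ^ 2 + D j ^ 2) atTop (𝓝 0) := by
  obtain ⟨B, hB⟩ := hf
  have hsum : Summable fun j => c * (‖∇ f (Z j)‖ ^ 2 + D j ^ 2) :=
    summable_of_le_sub_succ (fun j => mul_nonneg h.rate_pos.le (by positivity))
      (fun j => (hB _).trans (h.le_energy j)) h.mul_sq_le_energy_sub_energy_succ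
  simpa [inv_mul_cancel_left₀ h.rate_pos.ne'] using hsum.tendsto_atTop_zero.const_mul c⁻¹

theorem tendsto_norm_gradient (h : IsInexactDescent f p c C Z D s) (hf : ∃ B, ∀ x, B ≤ f x) :
    Tendsto (fun j => ‖∇ f (Z j)‖) atTop (𝓝 0) :=
  squeeze_zero (fun _ => norm_nonneg _)
    (fun _ => Real.le_sqrt_of_sq_le (le_add_of_nonneg_right (sq_nonneg _)))
    (by simpa using (h.tendsto_sq_add_sq hf).sqrt)

theorem tendsto_momentum (h : IsInexactDescent f p c C Z D s) (hf : ∃ B, ∀ x, B ≤ f x) :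
    Tendsto D atTop (𝓝 0) :=
  squeeze_zero h.momentum_nonneg
    (fun _ => Real.le_sqrt_of_sq_le (le_add_of_nonneg_left (sq_nonneg _)))
    (by simpa using (h.tendsto_sq_add_sq hf).sqrt)

theorem tendsto_error (h : IsInexactDescent f p c C Z D s) : Tendsto s atTop (𝓝 0) :=
  h.summable_error_self.tendsto_atTop_zero

theorem gradient_eq_zero_of_mapClusterPt (h : IsInexactDescent f p c C Z D s)
    (hf : ∃ B, ∀ x, B ≤ f x) (hfc : Continuous (∇ f)) {z : E} (hz : MapClusterPt z atTop Z) :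
    ∇ f z = 0 := by
  obtain ⟨φ, hφ, hφz⟩ := hz.tendsto_subseq
  exact norm_eq_zero.1 (tendsto_nhds_unique ((hfc.norm.tendsto z).comp hφz)
    ((h.tendsto_norm_gradient hf).comp hφ.tendsto_atTop))

theorem tendsto_energy_of_mapClusterPt (h : IsInexactDescent f p c C Z D s)
    (hf : ∃ B, ∀ x, B ≤ f x) (hfc : Continuous f) {z : E} (hz : MapClusterPt z atTop Z) :
    Tendsto (energy f C Z D s) atTop (𝓝 (f z)) := by
  obtain ⟨φ, hφ, hφz⟩ := hz.tendsto_subseq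
  have hsubseq : Tendsto (energy f C Z D s ∘ φ) atTop (𝓝 (f z)) := by
    simpa [energy, errorTail, Function.comp_def] using (((hfc.tendsto z).comp hφz).add
      (((h.tendsto_momentum hf).pow 2).comp hφ.tendsto_atTop)).add
      ((tendsto_sum_nat_add fun j => C * s j ^ 2).comp hφ.tendsto_atTop)
  obtain ⟨B, hB⟩ := hf
  have hbdd : BddBelow (Set.range (energy f C Z D s)) :=
    ⟨B, Set.forall_mem_range.2 fun j => (hB _).trans (h.le_energy j)⟩
  have hlim := tendsto_atTop_ciInf h.energy_antitone hbdd
  rwa [tendsto_nhds_unique hsubseq (hlim.comp hφ.tendsto_atTop)]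

theorem energy_sub_rpow_le (h : IsInexactDescent f p c C Z D s) {z : E} {θ C₀ : ℝ}
    (hθ : 1 / 2 ≤ θ) (hθ1 : θ ≤ 1) (hC₀ : 0 ≤ C₀) {j : ℕ} (hE : f z ≤ energy f C Z D s j)
    (hD : D j ≤ 1) (hloj : |f (Z j) - f z| ^ θ ≤ C₀ * ‖∇ f (Z j)‖) :
    (energy f C Z D s j - f z) ^ θ ≤
      (C₀ + 1) * (‖∇ f (Z j)‖ + D j + errorTail C s j ^ θ) := by
  have hθ0 : 0 ≤ θ := by linarith
  have hD0 := h.momentum_nonneg j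
  have hu := h.errorTail_nonneg j
  have huθ : 0 ≤ errorTail C s j ^ θ := Real.rpow_nonneg hu θ
  have hDθ : (D j ^ 2) ^ θ ≤ D j := by
    rw [← Real.rpow_natCast_mul hD0]
    exact Real.rpow_le_self_of_le_one hD0 hD (by push_cast; linarith)
  calc (energy f C Z D s j - f z) ^ θ
      ≤ (|f (Z j) - f z| + D j ^ 2 + errorTail C s j) ^ θ := by
        refine Real.rpow_le_rpow (sub_nonneg.2 hE) ?_ hθ0
        unfold energy
        linarith [le_abs_self (f (Z j) - f z)]
    _ ≤ (|f (Z j) - f z| + D j ^ 2) ^ θ + errorTail C s j ^ θ :=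
        Real.rpow_add_le_add_rpow (by positivity) hu hθ0 hθ1
    _ ≤ |f (Z j) - f z| ^ θ + (D j ^ 2) ^ θ + errorTail C s j ^ θ := by
        gcongr
        exact Real.rpow_add_le_add_rpow (by positivity) (by positivity) hθ0 hθ1
    _ ≤ C₀ * ‖∇ f (Z j)‖ + D j + errorTail C s j ^ θ := by gcongr
    _ ≤ (C₀ + 1) * (‖∇ f (Z j)‖ + D j + errorTail C s j ^ θ) := by
        nlinarith [norm_nonneg (∇ f (Z j)), mul_nonneg hC₀ hD0, mul_nonneg hC₀ huθ]

theorem norm_sub_le_of_energy_sub_rpow_le (h : IsInexactDescent f p c C Z D s) {z : E}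
    {θ C₁ : ℝ} (hθ0 : 0 ≤ θ) (hθ1 : θ < 1) (hC₁ : 0 ≤ C₁)
    (hE : ∀ j, f z ≤ energy f C Z D s j) {j : ℕ}
    (hloj : (energy f C Z D s j - f z) ^ θ ≤
      C₁ * (‖∇ f (Z j)‖ + D j + errorTail C s j ^ θ)) :
    ‖Z (j + 1) - Z j‖ ≤
      C * (2 * C₁ / (c / 2 * (1 - θ))) * (energy f C Z D s j - f z) ^ (1 - θ) -
        C * (2 * C₁ / (c / 2 * (1 - θ))) * (energy f C Z D s (j + 1) - f z) ^ (1 - θ) +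
        C * (errorTail C s j ^ θ + s j) := by
  have hdecrease : c / 2 * (‖∇ f (Z j)‖ + D j) ^ 2 ≤
      energy f C Z D s j - f z - (energy f C Z D s (j + 1) - f z) := by
    nlinarith [h.mul_sq_le_energy_sub_energy_succ j,
      mul_nonneg h.rate_pos.le (sq_nonneg (‖∇ f (Z j)‖ - D j))]
  have hlength := le_rpow_sub_rpow_add_of_decrease hθ0 hθ1
    (Real.rpow_nonneg (h.errorTail_nonneg j) θ) (half_pos h.rate_pos) hC₁ (sub_nonneg.2 (hE j))
    (sub_nonneg.2 (hE (j + 1))) hdecrease hloj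
  linarith [h.norm_sub_le j, mul_le_mul_of_nonneg_left hlength h.const_pos.le]

theorem tendsto_of_mapClusterPt_of_hasLojasiewiczExponent (h : IsInexactDescent f p c C Z D s)
    (hf : ∃ B, ∀ x, B ≤ f x) (hfc : Continuous f) {z : E} (hz : MapClusterPt z atTop Z) {θ : ℝ}
    (hθ : 1 / 2 ≤ θ) (hpθ : 1 / p < θ) (hθ1 : θ < 1) (hloj : HasLojasiewiczExponent f z θ) :
    Tendsto Z atTop (𝓝 z) := by
  obtain ⟨C₀, hC₀, hC₀loj⟩ := hloj.exists_pos
  have hElim := h.tendsto_energy_of_mapClusterPt hf hfc hz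
  have hE (j : ℕ) : f z ≤ energy f C Z D s j := h.energy_antitone.le_of_tendsto hElim j
  set K := C * (2 * (C₀ + 1) / (c / 2 * (1 - θ)))
  have hK : 0 ≤ K := by
    have := h.rate_pos
    have := h.const_pos
    have := sub_pos.2 hθ1
    positivity
  refine tendsto_of_dist_le_sub_add_of_mapClusterPt
    (Φ := fun j => K * (energy f C Z D s j - f z) ^ (1 - θ))
    (w := fun j => C * (errorTail C s j ^ θ + s j))
    (fun j => mul_nonneg hK (Real.rpow_nonneg (sub_nonneg.2 (hE j)) _)) ?_
    (fun j => mul_nonneg h.const_pos.le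
      (add_nonneg (Real.rpow_nonneg (h.errorTail_nonneg j) _) (h.error_nonneg j)))
    (((h.summable_errorTail_rpow hpθ).add h.summable_error_self).mul_left C) hz
    ⟨_, hC₀loj.bound, ?_⟩
  · have hzero := ((hElim.sub_const (f z)).rpow_const (p := 1 - θ)
      (Or.inr (by linarith))).const_mul K
    rwa [sub_self, Real.zero_rpow (by linarith), mul_zero] at hzero
  · filter_upwards [(h.tendsto_momentum hf).eventually_le_const one_pos] with j hDj hj
    rw [dist_eq_norm]
    refine h.norm_sub_le_of_energy_sub_rpow_le (by linarith) hθ1 (by positivity) hE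
      (h.energy_sub_rpow_le hθ hθ1.le hC₀.le (hE j) hDj ?_)
    exact (Real.norm_of_nonneg (by positivity)).symm.trans_le hj

theorem tendsto_of_mapClusterPt (h : IsInexactDescent f p c C Z D s)
    (hf : ∃ B, ∀ x, B ≤ f x) (hfc : Continuous f) {z : E} (hz : MapClusterPt z atTop Z)
    (hloj : ∃ θ < 1, HasLojasiewiczExponent f z θ) : Tendsto Z atTop (𝓝 z) := by
  obtain ⟨θ₀, hθ₀, hloj₀⟩ := hloj
  have hp : 1 / p < 1 := by
    rw [div_lt_one] <;> linarith [h.one_lt_exponent]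
  -- Near `z` the exponent may be increased, and `1 / p < θ` makes the tails `θ`-summable.
  obtain ⟨θ, hθ, hθ1⟩ := exists_between (max_lt (max_lt hθ₀ hp) one_half_lt_one)
  obtain ⟨⟨hθ₀θ, hpθ⟩, hhalf⟩ := And.imp_left max_lt_iff.1 (max_lt_iff.1 hθ)
  exact h.tendsto_of_mapClusterPt_of_hasLojasiewiczExponent hf hfc hz hhalf.le hpθ hθ1
    (hloj₀.mono hfc.continuousAt hθ₀θ.le (by linarith))

theorem tendsto_norm_atTop_or_tendsto [ProperSpace E] (h : IsInexactDescent f p c C Z D s)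
    (hf : ∃ B, ∀ x, B ≤ f x) (hfc : Continuous f) (hgc : Continuous (∇ f))
    (hloj : ∀ z, ∇ f z = 0 → ∃ θ < 1, HasLojasiewiczExponent f z θ) :
    Tendsto (fun j => ‖Z j‖) atTop atTop ∨ ∃ z, ∇ f z = 0 ∧ Tendsto Z atTop (𝓝 z) := by
  refine or_iff_not_imp_left.2 fun hnorm => ?_
  obtain ⟨z, hz⟩ := exists_mapClusterPt_of_not_tendsto_norm hnorm
  have hcrit := h.gradient_eq_zero_of_mapClusterPt hf hgc hz
  exact ⟨z, hcrit, h.tendsto_of_mapClusterPt hf hfc hz (hloj z hcrit)⟩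

end IsInexactDescent

end InexactDescent

section DescentLemma

variable {E : Type*} [NormedAddCommGroup E] [InnerProductSpace ℝ E] [CompleteSpace E]
  {f : E → ℝ} {L : ℝ≥0}

theorem le_add_inner_gradient_add_mul_norm_sq (hf : Differentiable ℝ f)
    (hL : LipschitzWith L (∇ f)) (x y : E) :
    f y ≤ f x + inner ℝ (∇ f x) (y - x) + L * ‖y - x‖ ^ 2 := by
  have hderiv : ∀ w ∈ segment ℝ x y,
      ‖fderiv ℝ f w - InnerProductSpace.toDual ℝ E (∇ f x)‖ ≤ L * ‖y - x‖ := by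
    intro w hw
    have hgrad : fderiv ℝ f w = InnerProductSpace.toDual ℝ E (∇ f w) := by simp [gradient]
    have hwx : dist w x ≤ dist y x := by
      rw [dist_comm w, dist_comm y]
      linarith [dist_add_dist_of_mem_segment hw, dist_nonneg (x := w) (y := y)]
    rw [hgrad, ← map_sub, LinearIsometryEquiv.norm_map, ← dist_eq_norm, ← dist_eq_norm]
    exact (hL.dist_le_mul w x).trans (by gcongr)
  have hmean := (convex_segment x y).norm_image_sub_le_of_norm_hasFDerivWithin_le'
    (fun w _ => (hf w).hasFDerivAt.hasFDerivWithinAt) hderiv (left_mem_segment ℝ x y)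
    (right_mem_segment ℝ x y)
  rw [InnerProductSpace.toDual_apply_apply, Real.norm_eq_abs] at hmean
  linarith [le_of_abs_le hmean, sq ‖y - x‖]

theorem le_of_norm_sub_add_smul_gradient_le (hf : Differentiable ℝ f)
    (hL : LipschitzWith L (∇ f)) {x y : E} {t R : ℝ} (ht : 0 ≤ t)
    (hR : ‖y - x + t • ∇ f x‖ ≤ R) :
    f y ≤ f x - t * ‖∇ f x‖ ^ 2 + ‖∇ f x‖ * R + L * (t * ‖∇ f x‖ + R) ^ 2 := by
  set r := y - x + t • ∇ f x with hr
  have hsub : y - x = r - t • ∇ f x := by rw [hr, add_sub_cancel_right]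
  have hinner : inner ℝ (∇ f x) (y - x) ≤ ‖∇ f x‖ * R - t * ‖∇ f x‖ ^ 2 := by
    rw [hsub, inner_sub_right, inner_smul_right, real_inner_self_eq_norm_sq]
    gcongr
    exact (real_inner_le_norm _ _).trans (by gcongr)
  have hnorm : ‖y - x‖ ≤ t * ‖∇ f x‖ + R := by
    rw [hsub]
    refine (norm_sub_le _ _).trans ?_
    rw [norm_smul, Real.norm_of_nonneg ht]
    linarith
  calc f y ≤ f x + inner ℝ (∇ f x) (y - x) + L * ‖y - x‖ ^ 2 :=
        le_add_inner_gradient_add_mul_norm_sq hf hL x y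
    _ ≤ f x + (‖∇ f x‖ * R - t * ‖∇ f x‖ ^ 2) + L * (t * ‖∇ f x‖ + R) ^ 2 := by gcongr
    _ = _ := by ring

end DescentLemma

section MomentumBlock

variable {F : Type*} [NormedAddCommGroup F] [NormedSpace ℝ F]

theorem sum_mul_pow_le {n : ℕ} {a : ℕ → ℝ} {lam A : ℝ} (hlam0 : 0 ≤ lam) (hlam1 : lam < 1)
    (hA : 0 ≤ A) (ha : ∀ i < n, a i ≤ A) :
    ∑ i ∈ Finset.range n, a i * lam ^ i ≤ A * (1 - lam)⁻¹ := by
  calc ∑ i ∈ Finset.range n, a i * lam ^ i ≤ ∑ i ∈ Finset.range n, A * lam ^ i :=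
        Finset.sum_le_sum fun i hi =>
          mul_le_mul_of_nonneg_right (ha i (Finset.mem_range.1 hi)) (pow_nonneg hlam0 i)
    _ = A * ∑ i ∈ Finset.range n, lam ^ i := (Finset.mul_sum _ _ _).symm
    _ ≤ A * ∑' i, lam ^ i := by
        gcongr
        exact (summable_geometric_of_lt_one hlam0 hlam1).sum_le_tsum _
          fun i _ => pow_nonneg hlam0 i
    _ = A * (1 - lam)⁻¹ := by rw [tsum_geometric_of_lt_one hlam0 hlam1]

/-- A block of `n` momentum steps with step sizes `a` of total length `T`, gradients `g` that stay
close to `γ`, and noise `e` whose weighted partial sums are at most `s`. The vectors `v` are the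
velocities and `z` the averaged iterates, for which the momentum term disappears from the recursion
and the step sizes are multiplied by `(1 - lam)⁻¹`. -/
structure IsMomentumBlock (lam B T s : ℝ) (n : ℕ) (a : ℕ → ℝ) (g e z v : ℕ → F) (γ : F) :
    Prop where
  lam_nonneg : 0 ≤ lam
  lam_lt_one : lam < 1
  inv_le : (1 - lam)⁻¹ ≤ B
  length_le : 4 * B ^ 2 * T ≤ 1
  step_nonneg : ∀ i < n, 0 ≤ a i
  step_le : ∀ i < n, a i ≤ T ^ 2
  sum_step : ∑ l ∈ Finset.range n, a l = T
  norm_noise_le : ∀ i ≤ n, ‖∑ l ∈ Finset.range i, a l • e l‖ ≤ s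
  velocity_succ : ∀ i < n, v (i + 1) = lam • v i - a i • (g i - e i)
  averaged_succ : ∀ i < n, z (i + 1) = z i - (a i * (1 - lam)⁻¹) • (g i - e i)
  norm_gradient_sub_le : ∀ i < n, ‖g i - γ‖ ≤ B * (‖z i - z 0‖ + ‖v i‖)

namespace IsMomentumBlock

variable {lam B T s M : ℝ} {n : ℕ} {a : ℕ → ℝ} {g e z v : ℕ → F} {γ : F}

theorem one_le_bound (h : IsMomentumBlock lam B T s n a g e z v γ) : 1 ≤ B :=
  ((one_le_inv₀ (sub_pos.2 h.lam_lt_one)).2 (by linarith [h.lam_nonneg])).trans h.inv_le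

theorem length_nonneg (h : IsMomentumBlock lam B T s n a g e z v γ) : 0 ≤ T :=
  h.sum_step ▸ Finset.sum_nonneg fun i hi => h.step_nonneg i (Finset.mem_range.1 hi)

theorem length_le_quarter (h : IsMomentumBlock lam B T s n a g e z v γ) : 4 * T ≤ 1 := by
  nlinarith [h.length_le, mul_nonneg h.length_nonneg
    (sub_nonneg.2 (one_le_pow₀ h.one_le_bound : 1 ≤ B ^ 2))]

theorem noise_nonneg (h : IsMomentumBlock lam B T s n a g e z v γ) : 0 ≤ s :=
  (norm_nonneg _).trans (h.norm_noise_le 0 n.zero_le)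

theorem norm_velocity_sub_noise_le (h : IsMomentumBlock lam B T s n a g e z v γ) (hM0 : 0 ≤ M)
    (hM : ∀ i < n, ‖g i‖ ≤ M) {i : ℕ} (hi : i ≤ n) :
    ‖v i - ∑ l ∈ Finset.range i, a l • e l‖ ≤
      lam ^ i * ‖v 0‖ + T ^ 2 * M * (1 - lam)⁻¹ + s := by
  have hone : 0 < 1 - lam := sub_pos.2 h.lam_lt_one
  have hinv : (1 - lam) * (1 - lam)⁻¹ = 1 := mul_inv_cancel₀ hone.ne'
  induction i with
  | zero =>
    have : 0 ≤ T ^ 2 * M * (1 - lam)⁻¹ := by positivity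
    simpa using (le_add_of_nonneg_right this).trans (le_add_of_nonneg_right h.noise_nonneg)
  | succ i ih =>
    have hlt : i < n := hi
    have hrec : v (i + 1) - ∑ l ∈ Finset.range (i + 1), a l • e l =
        lam • (v i - ∑ l ∈ Finset.range i, a l • e l)
          - (1 - lam) • (∑ l ∈ Finset.range i, a l • e l) - a i • g i := by
      rw [h.velocity_succ i hlt, Finset.sum_range_succ]
      module
    calc ‖v (i + 1) - ∑ l ∈ Finset.range (i + 1), a l • e l‖
        ≤ lam * ‖v i - ∑ l ∈ Finset.range i, a l • e l‖
          + (1 - lam) * ‖∑ l ∈ Finset.range i, a l • e l‖ + a i * ‖g i‖ := by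
          rw [hrec, ← norm_smul_of_nonneg h.lam_nonneg, ← norm_smul_of_nonneg hone.le,
            ← norm_smul_of_nonneg (h.step_nonneg i hlt)]
          exact (norm_sub_le _ _).trans (add_le_add_left (norm_sub_le _ _) _)
      _ ≤ lam * (lam ^ i * ‖v 0‖ + T ^ 2 * M * (1 - lam)⁻¹ + s) + (1 - lam) * s + T ^ 2 * M :=
          add_le_add (add_le_add (mul_le_mul_of_nonneg_left (ih hlt.le) h.lam_nonneg)
            (mul_le_mul_of_nonneg_left (h.norm_noise_le i hlt.le) hone.le))
            (mul_le_mul (h.step_le i hlt) (hM i hlt) (norm_nonneg _) (sq_nonneg T))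
      _ = lam ^ (i + 1) * ‖v 0‖ + T ^ 2 * M * (1 - lam)⁻¹ + s := by
          linear_combination (-T ^ 2 * M) * hinv

theorem norm_velocity_le (h : IsMomentumBlock lam B T s n a g e z v γ) (hM0 : 0 ≤ M)
    (hM : ∀ i < n, ‖g i‖ ≤ M) {i : ℕ} (hi : i ≤ n) :
    ‖v i‖ ≤ lam ^ i * ‖v 0‖ + B * T ^ 2 * M + 2 * s := by
  calc ‖v i‖ ≤ ‖v i - ∑ l ∈ Finset.range i, a l • e l‖ + ‖∑ l ∈ Finset.range i, a l • e l‖ :=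
        norm_le_norm_sub_add _ _
    _ ≤ (lam ^ i * ‖v 0‖ + T ^ 2 * M * (1 - lam)⁻¹ + s) + s :=
        add_le_add (h.norm_velocity_sub_noise_le hM0 hM hi) (h.norm_noise_le i hi)
    _ ≤ (lam ^ i * ‖v 0‖ + T ^ 2 * M * B + s) + s := by
        gcongr
        exact h.inv_le
    _ = lam ^ i * ‖v 0‖ + B * T ^ 2 * M + 2 * s := by ring

theorem averaged_sub_eq (h : IsMomentumBlock lam B T s n a g e z v γ) {i : ℕ} (hi : i ≤ n) :
    z i - z 0 = (1 - lam)⁻¹ •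
      (∑ l ∈ Finset.range i, a l • e l - ∑ l ∈ Finset.range i, a l • g l) := by
  induction i with
  | zero => simp
  | succ i ih =>
    have hrec : z (i + 1) - z 0 = (z i - z 0) - (a i * (1 - lam)⁻¹) • (g i - e i) := by
      rw [h.averaged_succ i hi]
      abel
    rw [hrec, ih (Nat.le_of_succ_le hi), Finset.sum_range_succ, Finset.sum_range_succ]
    module

theorem norm_averaged_sub_le (h : IsMomentumBlock lam B T s n a g e z v γ) (hM0 : 0 ≤ M)
    (hM : ∀ i < n, ‖g i‖ ≤ M) {i : ℕ} (hi : i ≤ n) : ‖z i - z 0‖ ≤ B * (T * M + s) := by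
  have hsum : ‖∑ l ∈ Finset.range i, a l • g l‖ ≤ T * M := by
    calc ‖∑ l ∈ Finset.range i, a l • g l‖ ≤ ∑ l ∈ Finset.range i, a l * M := by
          refine norm_sum_le_of_le _ fun l hl => ?_
          have hlt : l < n := (Finset.mem_range.1 hl).trans_le hi
          rw [norm_smul_of_nonneg (h.step_nonneg l hlt)]
          exact mul_le_mul_of_nonneg_left (hM l hlt) (h.step_nonneg l hlt)
      _ = (∑ l ∈ Finset.range i, a l) * M := (Finset.sum_mul _ _ _).symm
      _ ≤ T * M := by
          rw [← h.sum_step]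
          exact mul_le_mul_of_nonneg_right (Finset.sum_le_sum_of_subset_of_nonneg
            (Finset.range_mono hi) fun l hl _ => h.step_nonneg l (Finset.mem_range.1 hl)) hM0
  rw [h.averaged_sub_eq hi, norm_smul_of_nonneg (inv_nonneg.2 (sub_pos.2 h.lam_lt_one).le)]
  refine mul_le_mul h.inv_le ((norm_sub_le _ _).trans ?_) (norm_nonneg _)
    (zero_le_one.trans h.one_le_bound)
  linarith [h.norm_noise_le i hi]

theorem norm_gradient_sub_le_of_bound (h : IsMomentumBlock lam B T s n a g e z v γ) (hM0 : 0 ≤ M)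
    (hM : ∀ i < n, ‖g i‖ ≤ M) {i : ℕ} (hi : i < n) :
    ‖g i - γ‖ ≤ 2 * B ^ 2 * T * M + 3 * B ^ 2 * s + B * ‖v 0‖ * lam ^ i := by
  have hB := h.one_le_bound
  have hs := h.noise_nonneg
  have hT := h.length_nonneg
  have hTsq : T ^ 2 ≤ T := by nlinarith [h.length_le_quarter]
  have hBsq : B ≤ B ^ 2 := le_self_pow₀ hB two_ne_zero
  calc ‖g i - γ‖ ≤ B * (‖z i - z 0‖ + ‖v i‖) := h.norm_gradient_sub_le i hi
    _ ≤ B * (B * (T * M + s) + (lam ^ i * ‖v 0‖ + B * T ^ 2 * M + 2 * s)) := by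
        gcongr
        · exact h.norm_averaged_sub_le hM0 hM hi.le
        · exact h.norm_velocity_le hM0 hM hi.le
    _ ≤ B * (B * (T * M + s) + (lam ^ i * ‖v 0‖ + B * T * M + 2 * s)) := by gcongr
    _ = 2 * B ^ 2 * T * M + (B ^ 2 + 2 * B) * s + B * ‖v 0‖ * lam ^ i := by ring
    _ ≤ 2 * B ^ 2 * T * M + (B ^ 2 + 2 * B ^ 2) * s + B * ‖v 0‖ * lam ^ i := by gcongr
    _ = _ := by ring

theorem norm_gradient_le (h : IsMomentumBlock lam B T s n a g e z v γ) {i : ℕ} (hi : i < n) :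
    ‖g i‖ ≤ 2 * (‖γ‖ + 3 * B ^ 2 * s + B * ‖v 0‖) := by
  obtain ⟨i₀, hi₀, hmax⟩ := Finset.exists_max_image (Finset.range n) (fun i => ‖g i‖)
    ⟨i, Finset.mem_range.2 hi⟩
  simp only [Finset.mem_range] at hi₀ hmax
  have hB := h.one_le_bound
  have hdev := h.norm_gradient_sub_le_of_bound (norm_nonneg (g i₀)) hmax hi₀
  have hpow : B * ‖v 0‖ * lam ^ i₀ ≤ B * ‖v 0‖ :=
    mul_le_of_le_one_right (by positivity) (pow_le_one₀ h.lam_nonneg h.lam_lt_one.le)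
  have hhalf : 4 * B ^ 2 * T * ‖g i₀‖ ≤ 1 * ‖g i₀‖ := by
    gcongr
    exact h.length_le
  linarith [hmax i hi, norm_le_norm_sub_add (g i₀) γ]

theorem norm_sum_smul_gradient_sub_le (h : IsMomentumBlock lam B T s n a g e z v γ) (hM0 : 0 ≤ M)
    (hM : ∀ i < n, ‖g i‖ ≤ M) :
    ‖∑ l ∈ Finset.range n, a l • (g l - γ)‖ ≤
      T * (2 * B ^ 2 * T * M + 3 * B ^ 2 * s) + B * ‖v 0‖ * (T ^ 2 * B) := by
  have hB := h.one_le_bound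
  calc ‖∑ l ∈ Finset.range n, a l • (g l - γ)‖
      ≤ ∑ l ∈ Finset.range n, (a l * (2 * B ^ 2 * T * M + 3 * B ^ 2 * s)
          + B * ‖v 0‖ * (a l * lam ^ l)) := by
        refine norm_sum_le_of_le _ fun l hl => ?_
        have hlt := Finset.mem_range.1 hl
        rw [norm_smul_of_nonneg (h.step_nonneg l hlt)]
        refine (mul_le_mul_of_nonneg_left (h.norm_gradient_sub_le_of_bound hM0 hM hlt)
          (h.step_nonneg l hlt)).trans_eq ?_
        ring
    _ = T * (2 * B ^ 2 * T * M + 3 * B ^ 2 * s)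
          + B * ‖v 0‖ * ∑ l ∈ Finset.range n, a l * lam ^ l := by
        rw [Finset.sum_add_distrib, ← Finset.sum_mul, h.sum_step, ← Finset.mul_sum]
    _ ≤ _ := by
        gcongr
        exact (sum_mul_pow_le h.lam_nonneg h.lam_lt_one (sq_nonneg T) h.step_le).trans
          (mul_le_mul_of_nonneg_left h.inv_le (sq_nonneg T))

theorem norm_averaged_sub_add_smul_le (h : IsMomentumBlock lam B T s n a g e z v γ) :
    ‖z n - z 0 + (T * (1 - lam)⁻¹) • γ‖ ≤ 16 * B ^ 5 * (T ^ 2 * (‖γ‖ + ‖v 0‖) + s) := by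
  have hB := h.one_le_bound
  have hs := h.noise_nonneg
  have hT := h.length_nonneg
  have hT1 : T ≤ 1 := by linarith [h.length_le_quarter]
  have hTsq : T ^ 2 ≤ 1 := pow_le_one₀ hT hT1
  have heq : z n - z 0 + (T * (1 - lam)⁻¹) • γ = (1 - lam)⁻¹ •
      (∑ l ∈ Finset.range n, a l • e l - ∑ l ∈ Finset.range n, a l • (g l - γ)) := by
    rw [h.averaged_sub_eq le_rfl, ← h.sum_step]
    simp only [smul_sub, Finset.sum_sub_distrib, ← Finset.sum_smul]
    module
  rw [heq, norm_smul_of_nonneg (inv_nonneg.2 (sub_pos.2 h.lam_lt_one).le)]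
  set M := 2 * (‖γ‖ + 3 * B ^ 2 * s + B * ‖v 0‖) with hM
  calc (1 - lam)⁻¹ * ‖_‖
      ≤ B * (s + (T * (2 * B ^ 2 * T * M + 3 * B ^ 2 * s) + B * ‖v 0‖ * (T ^ 2 * B))) :=
        mul_le_mul h.inv_le ((norm_sub_le _ _).trans (add_le_add (h.norm_noise_le n le_rfl)
          (h.norm_sum_smul_gradient_sub_le (by positivity) fun i hi => h.norm_gradient_le hi)))
          (norm_nonneg _) (by positivity)
    _ = T ^ 2 * (4 * B ^ 3 * ‖γ‖ + (4 * B ^ 4 + B ^ 3) * ‖v 0‖)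
          + (B ^ 1 + 12 * B ^ 5 * T ^ 2 + 3 * B ^ 3 * T) * s := by rw [hM]; ring
    _ ≤ T ^ 2 * (4 * B ^ 5 * ‖γ‖ + (4 * B ^ 5 + B ^ 5) * ‖v 0‖)
          + (B ^ 5 + 12 * B ^ 5 * 1 + 3 * B ^ 5 * 1) * s := by
        gcongr <;> norm_num
    _ ≤ 16 * B ^ 5 * (T ^ 2 * (‖γ‖ + ‖v 0‖) + s) := by
        have : 0 ≤ T ^ 2 * (12 * B ^ 5 * ‖γ‖ + 11 * B ^ 5 * ‖v 0‖) := by positivity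
        linarith

theorem norm_velocity_last_le (h : IsMomentumBlock lam B T s n a g e z v γ) :
    ‖v n‖ ≤ lam ^ n * ‖v 0‖ + 16 * B ^ 5 * (T ^ 2 * (‖γ‖ + ‖v 0‖) + s) := by
  have hB := h.one_le_bound
  have hs := h.noise_nonneg
  have hTsq : T ^ 2 ≤ 1 := pow_le_one₀ h.length_nonneg (by linarith [h.length_le_quarter])
  calc ‖v n‖ ≤ lam ^ n * ‖v 0‖
          + B * T ^ 2 * (2 * (‖γ‖ + 3 * B ^ 2 * s + B * ‖v 0‖)) + 2 * s :=
        h.norm_velocity_le (by positivity) (fun i hi => h.norm_gradient_le hi) le_rfl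
    _ = lam ^ n * ‖v 0‖ + T ^ 2 * (2 * B ^ 1 * ‖γ‖ + 2 * B ^ 2 * ‖v 0‖)
          + (6 * B ^ 3 * T ^ 2 + 2 * B ^ 0) * s := by ring
    _ ≤ lam ^ n * ‖v 0‖ + T ^ 2 * (2 * B ^ 5 * ‖γ‖ + 2 * B ^ 5 * ‖v 0‖)
          + (6 * B ^ 5 * 1 + 2 * B ^ 5) * s := by
        gcongr <;> norm_num
    _ ≤ lam ^ n * ‖v 0‖ + 16 * B ^ 5 * (T ^ 2 * (‖γ‖ + ‖v 0‖) + s) := by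
        have : 0 ≤ B ^ 5 * (T ^ 2 * (14 * ‖γ‖ + 14 * ‖v 0‖) + 8 * s) := by positivity
        linarith

theorem norm_averaged_sub_add_norm_velocity_le (h : IsMomentumBlock lam B T s n a g e z v γ)
    {i : ℕ} (hi : i ≤ n) :
    ‖z i - z 0‖ + ‖v i‖ ≤ 16 * B ^ 5 * (‖γ‖ + ‖v 0‖ + s) := by
  have hB := h.one_le_bound
  have hs := h.noise_nonneg
  have hT := h.length_nonneg
  have hT1 : T ≤ 1 / 4 := by linarith [h.length_le_quarter]
  have hTsq : T ^ 2 ≤ 1 / 4 := by nlinarith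
  have hlam : lam ^ i ≤ 1 := pow_le_one₀ h.lam_nonneg h.lam_lt_one.le
  set M := 2 * (‖γ‖ + 3 * B ^ 2 * s + B * ‖v 0‖) with hM
  have hM0 : 0 ≤ M := by positivity
  have hgM : ∀ i < n, ‖g i‖ ≤ M := fun i hi => h.norm_gradient_le hi
  calc ‖z i - z 0‖ + ‖v i‖
      ≤ B * (T * M + s) + (lam ^ i * ‖v 0‖ + B * T ^ 2 * M + 2 * s) :=
        add_le_add (h.norm_averaged_sub_le hM0 hgM hi) (h.norm_velocity_le hM0 hgM hi)
    _ ≤ B * (1 / 4 * M + s) + (1 * ‖v 0‖ + B * (1 / 4) * M + 2 * s) := by gcongr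
    _ = B ^ 1 * ‖γ‖ + (B ^ 2 + B ^ 0) * ‖v 0‖ + (3 * B ^ 3 + B ^ 1 + 2 * B ^ 0) * s := by
        rw [hM]; ring
    _ ≤ B ^ 5 * ‖γ‖ + (B ^ 5 + B ^ 5) * ‖v 0‖ + (3 * B ^ 5 + B ^ 5 + 2 * B ^ 5) * s := by
        gcongr <;> norm_num
    _ ≤ 16 * B ^ 5 * (‖γ‖ + ‖v 0‖ + s) := by
        have : 0 ≤ B ^ 5 * (15 * ‖γ‖ + 14 * ‖v 0‖ + 10 * s) := by positivity
        linarith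

end IsMomentumBlock

end MomentumBlock

section LyapunovArithmetic

variable {f₀ f₁ G D D' T b K L ρ s : ℝ}

theorem add_sq_le_of_inexact_step (hT : 0 < T) (hb0 : 0 ≤ b) (hbK : b ≤ K)
    (hLK : L ≤ K) (hK : 1 ≤ K) (hKT : 100 * K ^ 3 * T ≤ 1) (hG : 0 ≤ G) (hρ : 0 ≤ ρ)
    (hD : 0 ≤ D') (hD' : D' ≤ D / 4 + ρ)
    (hf : f₁ ≤ f₀ - T * b * G ^ 2 + G * ρ + L * (T * b * G + ρ) ^ 2) :
    f₁ + D' ^ 2 ≤ f₀ - T * b * G ^ 2 + 27 / 100 * T * G ^ 2 + D ^ 2 / 8 + 2 / T * ρ ^ 2 := by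
  have hcube : K ≤ K ^ 3 := le_self_pow₀ hK three_ne_zero
  have hKT' : 100 * K * T ≤ 1 := by nlinarith
  have hT1 : 100 * T ≤ 1 := by nlinarith
  have hinv : 100 * K ≤ 1 / T := (le_div_iff₀ hT).2 hKT'
  have hcross : G * ρ ≤ T / 4 * G ^ 2 + 1 / T * ρ ^ 2 := by
    have heq : T / 4 * G ^ 2 + 1 / T * ρ ^ 2 - G * ρ = (T / 2 * G - ρ) ^ 2 / T := by
      field_simp
      ring
    have : 0 ≤ (T / 2 * G - ρ) ^ 2 / T := by positivity
    linarith
  have hquad : L * (T * b * G + ρ) ^ 2 ≤ T / 50 * G ^ 2 + 2 * K * ρ ^ 2 := by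
    calc L * (T * b * G + ρ) ^ 2 ≤ K * (T * K * G + ρ) ^ 2 := by gcongr
      _ ≤ K * (2 * ((T * K * G) ^ 2 + ρ ^ 2)) := by gcongr; exact add_sq_le
      _ = 100 * K ^ 3 * T * (T / 50 * G ^ 2) + 2 * K * ρ ^ 2 := by ring
      _ ≤ 1 * (T / 50 * G ^ 2) + 2 * K * ρ ^ 2 := by gcongr
      _ = _ := by ring
  have hvel : D' ^ 2 ≤ D ^ 2 / 8 + 2 * ρ ^ 2 := by
    nlinarith [pow_le_pow_left₀ hD hD' 2, sq_nonneg (D / 4 - ρ)]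
  have hcoef : (2 * K + 2) * ρ ^ 2 ≤ 1 / T * ρ ^ 2 := by
    gcongr
    linarith
  have htwo : 2 / T * ρ ^ 2 = 1 / T * ρ ^ 2 + 1 / T * ρ ^ 2 := by ring
  linarith

theorem lyapunov_decrease (hT : 0 < T) (hb : 1 ≤ b) (hbK : b ≤ K)
    (hLK : L ≤ K) (hKT : 100 * K ^ 3 * T ≤ 1) (hG : 0 ≤ G) (hD0 : 0 ≤ D) (hs : 0 ≤ s)
    (hD : 0 ≤ D') (hD' : D' ≤ D / 4 + K * (T ^ 2 * (G + D) + s))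
    (hf : f₁ ≤ f₀ - T * b * G ^ 2 + G * (K * (T ^ 2 * (G + D) + s)) +
      L * (T * b * G + K * (T ^ 2 * (G + D) + s)) ^ 2) :
    f₁ + D' ^ 2 ≤ f₀ + D ^ 2 - T / 2 * (G ^ 2 + D ^ 2) + 6 * K ^ 2 / T * s ^ 2 := by
  have hK : 1 ≤ K := hb.trans hbK
  have hT1 : 100 * T ≤ 1 := by nlinarith [one_le_pow₀ hK (n := 3)]
  have hsq : (K * (T ^ 2 * (G + D) + s)) ^ 2 ≤
      3 * K ^ 2 * (T ^ 4 * (G ^ 2 + D ^ 2) + s ^ 2) := by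
    have : 0 ≤ K ^ 2 * ((T ^ 2 * G - T ^ 2 * D) ^ 2 + (T ^ 2 * G - s) ^ 2
        + (T ^ 2 * D - s) ^ 2) := by positivity
    linarith
  have hρ : 2 / T * (K * (T ^ 2 * (G + D) + s)) ^ 2 ≤
      T / 100 * (G ^ 2 + D ^ 2) + 6 * K ^ 2 / T * s ^ 2 := by
    have hcoef : 6 * K ^ 2 * T ^ 3 ≤ T / 100 := by
      have hsquare : K ^ 2 ≤ K ^ 3 := pow_le_pow_right₀ hK (by norm_num)
      calc 6 * K ^ 2 * T ^ 3 ≤ 6 * K ^ 3 * T ^ 3 := by gcongr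
        _ = 6 / 100 * (100 * K ^ 3 * T) * T ^ 2 := by ring
        _ ≤ 6 / 100 * 1 * T ^ 2 := by gcongr
        _ ≤ T / 100 := by nlinarith
    calc 2 / T * (K * (T ^ 2 * (G + D) + s)) ^ 2
        ≤ 2 / T * (3 * K ^ 2 * (T ^ 4 * (G ^ 2 + D ^ 2) + s ^ 2)) := by gcongr
      _ = 6 * K ^ 2 * T ^ 3 * (G ^ 2 + D ^ 2) + 6 * K ^ 2 / T * s ^ 2 := by
          field_simp
          ring
      _ ≤ T / 100 * (G ^ 2 + D ^ 2) + 6 * K ^ 2 / T * s ^ 2 := by gcongr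
  have hstep := add_sq_le_of_inexact_step hT (zero_le_one.trans hb) hbK hLK hK hKT hG
    (by positivity) hD hD' hf
  have hTb : T * 1 * G ^ 2 ≤ T * b * G ^ 2 := by gcongr
  nlinarith [mul_nonneg hT.le (sq_nonneg G), sq_nonneg D]

end LyapunovArithmetic

section BlockPartition

variable {α w : ℕ → ℝ} {τ δ r : ℝ} {m : ℕ → ℕ}

theorem exists_sum_Ico_mem_Icc {a : ℕ} (hτ : 0 < τ) (hα : ∀ k, a ≤ k → α k ≤ τ)
    (hex : ∃ b, τ ≤ ∑ k ∈ Finset.Ico a b, α k) :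
    ∃ b, a < b ∧ ∑ k ∈ Finset.Ico a b, α k ∈ Set.Icc τ (2 * τ) := by
  classical
  have hspec := Nat.find_spec hex
  have hlt : a < Nat.find hex := by
    by_contra! hle
    rw [Finset.Ico_eq_empty_of_le hle, Finset.sum_empty] at hspec
    exact hspec.not_gt hτ
  obtain ⟨n, hn⟩ := Nat.exists_eq_add_one_of_ne_zero (Nat.ne_zero_of_lt hlt)
  have hmin : ∑ k ∈ Finset.Ico a n, α k < τ := not_le.1 (Nat.find_min hex (by omega))
  refine ⟨Nat.find hex, hlt, hspec, ?_⟩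
  rw [hn, Finset.sum_Ico_succ_top (by omega)]
  linarith [hα n (by omega)]

theorem exists_le_sum_Ico (hα : Tendsto (fun n : ℕ => ∑ k ∈ Finset.Icc 1 n, α k) atTop atTop)
    {a : ℕ} (ha : 1 ≤ a) (τ : ℝ) : ∃ b, τ ≤ ∑ k ∈ Finset.Ico a b, α k := by
  obtain ⟨n, hsum, hn⟩ := ((hα.eventually_ge_atTop (∑ k ∈ Finset.Ico 1 a, α k + τ)).and
    (eventually_ge_atTop a)).exists
  refine ⟨n + 1, ?_⟩
  rw [← Finset.Ico_add_one_right_eq_Icc,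
    ← Finset.sum_Ico_consecutive α ha (hn.trans n.le_succ : a ≤ n + 1)] at hsum
  linarith

/-- The indices `m 0 < m 1 < ⋯` cut the steps from `m 0` on into consecutive blocks, each of which
has a total step size between `τ` and `2 * τ` and consists of steps of size at most `δ`. -/
structure IsBlockPartition (α : ℕ → ℝ) (τ δ : ℝ) (m : ℕ → ℕ) : Prop where
  strictMono : StrictMono m
  one_le_start : 1 ≤ m 0
  step_nonneg : ∀ k, m 0 ≤ k → 0 ≤ α k
  step_le : ∀ k, m 0 ≤ k → α k ≤ δ
  le_sum : ∀ j, τ ≤ ∑ k ∈ Finset.Ico (m j) (m (j + 1)), α k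
  sum_le : ∀ j, ∑ k ∈ Finset.Ico (m j) (m (j + 1)), α k ≤ 2 * τ

theorem exists_isBlockPartition (hα : ∀ k, 1 ≤ k → 0 ≤ α k)
    (hαsum : Tendsto (fun n : ℕ => ∑ k ∈ Finset.Icc 1 n, α k) atTop atTop)
    (hαlim : Tendsto α atTop (𝓝 0)) (hτ : 0 < τ) (hδ : 0 < δ) :
    ∃ m, IsBlockPartition α τ δ m := by
  obtain ⟨N, hN⟩ := eventually_atTop.1 ((eventually_ge_atTop 1).and
    (hαlim.eventually_le_const (lt_min hδ hτ)))
  have hnext : ∀ a : ℕ, ∃ b, a < b ∧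
      (N ≤ a → ∑ k ∈ Finset.Ico a b, α k ∈ Set.Icc τ (2 * τ)) := by
    intro a
    by_cases ha : N ≤ a
    · obtain ⟨b, hab, hb⟩ := exists_sum_Ico_mem_Icc hτ
        (fun k hk => (hN k (ha.trans hk)).2.trans (min_le_right δ τ))
        (exists_le_sum_Ico hαsum (hN a ha).1 τ)
      exact ⟨b, hab, fun _ => hb⟩
    · exact ⟨a + 1, a.lt_succ_self, fun h => absurd h ha⟩
  choose next hlt hnext using hnext
  let m : ℕ → ℕ := fun j => next^[j] N
  have hsucc : ∀ j, m (j + 1) = next (m j) := fun j => Function.iterate_succ_apply' next j N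
  have hmono : StrictMono m := strictMono_nat_of_lt_succ fun j => hsucc j ▸ hlt (m j)
  have hmem : ∀ j, ∑ k ∈ Finset.Ico (m j) (m (j + 1)), α k ∈ Set.Icc τ (2 * τ) := fun j =>
    hsucc j ▸ hnext (m j) (hmono.monotone j.zero_le)
  exact ⟨m, hmono, (hN N le_rfl).1, fun k hk => hα k (hN k hk).1,
    fun k hk => (hN k hk).2.trans (min_le_left δ τ), fun j => (hmem j).1, fun j => (hmem j).2⟩

theorem sum_range_sum_Ico (hm : Monotone m) (w : ℕ → ℝ) (n : ℕ) :
    ∑ j ∈ Finset.range n, ∑ k ∈ Finset.Ico (m j) (m (j + 1)), w k =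
      ∑ k ∈ Finset.Ico (m 0) (m n), w k := by
  induction n with
  | zero => simp
  | succ n ih =>
    rw [Finset.sum_range_succ, ih, Finset.sum_Ico_consecutive w (hm n.zero_le) (hm n.le_succ)]

theorem summable_sum_Ico (hm : Monotone m) (hw₀ : ∀ k, 0 ≤ w k) (hw : Summable w) :
    Summable fun j => ∑ k ∈ Finset.Ico (m j) (m (j + 1)), w k :=
  summable_of_sum_range_le (c := ∑' k, w k) (fun _ => Finset.sum_nonneg fun k _ => hw₀ k)
    fun n => (sum_range_sum_Ico hm w n).trans_le (hw.sum_le_tsum _ fun k _ => hw₀ k)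

theorem exists_tendsto_block_index (hm : StrictMono m) :
    ∃ J : ℕ → ℕ, Tendsto J atTop atTop ∧ ∀ k, m 0 ≤ k → m (J k) ≤ k ∧ k < m (J k + 1) := by
  have hcover : ⋃ j, Set.Ico (m j) (m (j + 1)) = Set.Ici (m 0) :=
    iUnion_Ico_map_succ_eq_Ici (fun j => hm.monotone j.zero_le)
      hm.not_bddAbove_range_of_isSuccArchimedean
  have hex : ∀ k, ∃ j, m 0 ≤ k → m j ≤ k ∧ k < m (j + 1) := fun k =>
    if hk : m 0 ≤ k then (Set.mem_iUnion.1 (hcover.ge hk)).imp fun _ hj _ => hj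
    else ⟨0, fun h => absurd h hk⟩
  choose J hJ using hex
  refine ⟨J, tendsto_atTop.2 fun b => ?_, hJ⟩
  filter_upwards [eventually_ge_atTop (m b), eventually_ge_atTop (m 0)] with k hkb hk0
  exact Nat.lt_succ_iff.1 (hm.lt_iff_lt.1 (hkb.trans_lt (hJ k hk0).2))

theorem tendsto_stepSize_zero (hα : ∀ k, 1 ≤ k → 0 < α k) (hr : 0 ≤ r)
    (hsum : Summable fun k : ℕ =>
      α (k + 1) ^ 2 * (∑ i ∈ Finset.Icc 1 (k + 1), α i) ^ (2 * r)) :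
    Tendsto α atTop (𝓝 0) := by
  have hα₁ : 0 < α 1 ^ (2 * r) := Real.rpow_pos_of_pos (hα 1 le_rfl) _
  have hsq : Summable fun k => α (k + 1) ^ 2 := by
    refine .of_nonneg_of_le (fun k => sq_nonneg _) (fun k => ?_)
      (hsum.mul_right (α 1 ^ (2 * r))⁻¹)
    rw [← div_eq_mul_inv, le_div_iff₀ hα₁]
    gcongr
    · exact (hα 1 le_rfl).le
    · exact Finset.single_le_sum (f := α) (fun i hi => (hα i (Finset.mem_Icc.1 hi).1).le)
        (Finset.mem_Icc.2 ⟨le_rfl, by omega⟩)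
  rw [← tendsto_add_atTop_iff_nat 1]
  rw [← Real.sqrt_zero]
  exact hsq.tendsto_atTop_zero.sqrt.congr fun k => Real.sqrt_sq (hα _ (by omega)).le

namespace IsBlockPartition

theorem add_length (h : IsBlockPartition α τ δ m) (j : ℕ) :
    m j + (m (j + 1) - m j) = m (j + 1) :=
  Nat.add_sub_of_le (h.strictMono.monotone j.le_succ)

theorem start_le_add (h : IsBlockPartition α τ δ m) (j l : ℕ) : m 0 ≤ m j + l :=
  (h.strictMono.monotone j.zero_le).trans (Nat.le_add_right _ _)

theorem le_length_mul (h : IsBlockPartition α τ δ m) (j : ℕ) :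
    τ ≤ (m (j + 1) - m j : ℕ) * δ := by
  calc τ ≤ ∑ l ∈ Finset.range (m (j + 1) - m j), α (m j + l) :=
        (h.le_sum j).trans_eq (Finset.sum_Ico_eq_sum_range α _ _)
    _ ≤ ∑ _l ∈ Finset.range (m (j + 1) - m j), δ :=
        Finset.sum_le_sum fun l _ => h.step_le _ (h.start_le_add j l)
    _ = (m (j + 1) - m j : ℕ) * δ := by simp

theorem mul_le_sum_Icc (h : IsBlockPartition α τ δ m) (hα : ∀ k, 1 ≤ k → 0 ≤ α k) {j k : ℕ}
    (hk : m j ≤ k) : min (α 1) τ / 2 * ((j : ℝ) + 1) ≤ ∑ i ∈ Finset.Icc 1 k, α i := by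
  have hnonneg : ∀ i ∈ Finset.Icc 1 k, 0 ≤ α i := fun i hi => hα i (Finset.mem_Icc.1 hi).1
  have hstart : 1 ≤ m j := h.one_le_start.trans (h.strictMono.monotone j.zero_le)
  have hfirst : α 1 ≤ ∑ i ∈ Finset.Icc 1 k, α i :=
    Finset.single_le_sum hnonneg (Finset.mem_Icc.2 ⟨le_rfl, hstart.trans hk⟩)
  have hblocks : j * τ ≤ ∑ i ∈ Finset.Icc 1 k, α i := by
    calc j * τ = ∑ _i ∈ Finset.range j, τ := by simp
      _ ≤ ∑ i ∈ Finset.range j, ∑ k ∈ Finset.Ico (m i) (m (i + 1)), α k :=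
          Finset.sum_le_sum fun i _ => h.le_sum i
      _ = ∑ k ∈ Finset.Ico (m 0) (m j), α k := sum_range_sum_Ico h.strictMono.monotone α j
      _ ≤ _ := Finset.sum_le_sum_of_subset_of_nonneg (fun i hi => by
          have := h.one_le_start
          simp only [Finset.mem_Ico, Finset.mem_Icc] at hi ⊢
          omega) fun i hi _ => hnonneg i hi
  have hmin : (j : ℝ) * min (α 1) τ ≤ j * τ := by gcongr; exact min_le_right _ _
  linarith [min_le_left (α 1) τ]

theorem summable_rpow_mul_sum_sq (h : IsBlockPartition α τ δ m) (hτ : 0 < τ)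
    (hα : ∀ k, 1 ≤ k → 0 < α k) (hr : 0 ≤ r)
    (hsum : Summable fun k : ℕ =>
      α (k + 1) ^ 2 * (∑ i ∈ Finset.Icc 1 (k + 1), α i) ^ (2 * r)) :
    Summable fun j : ℕ =>
      ((j : ℝ) + 1) ^ (2 * r) * ∑ k ∈ Finset.Ico (m j) (m (j + 1)), α k ^ 2 := by
  set c := min (α 1) τ / 2
  have hc₀ : 0 < c := half_pos (lt_min (hα 1 le_rfl) hτ)
  have hα' : ∀ k, 1 ≤ k → 0 ≤ α k := fun k hk => (hα k hk).le
  set w : ℕ → ℝ := fun k => α k ^ 2 * (∑ i ∈ Finset.Icc 1 k, α i) ^ (2 * r)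
  have hw₀ : ∀ k, 0 ≤ w k := fun k => mul_nonneg (sq_nonneg _)
    (Real.rpow_nonneg (Finset.sum_nonneg fun i hi => hα' i (Finset.mem_Icc.1 hi).1) _)
  have hblock : ∀ j : ℕ, ((j : ℝ) + 1) ^ (2 * r) * ∑ k ∈ Finset.Ico (m j) (m (j + 1)), α k ^ 2 ≤
      (c ^ (2 * r))⁻¹ * ∑ k ∈ Finset.Ico (m j) (m (j + 1)), w k := by
    intro j
    rw [Finset.mul_sum, Finset.mul_sum]
    refine Finset.sum_le_sum fun k hk => ?_
    rw [inv_mul_eq_div, le_div_iff₀ (Real.rpow_pos_of_pos hc₀ _), mul_right_comm,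
      ← Real.mul_rpow (by positivity) hc₀.le, mul_comm _ c, mul_comm]
    exact mul_le_mul_of_nonneg_left (Real.rpow_le_rpow (by positivity)
      (h.mul_le_sum_Icc hα' (Finset.mem_Ico.1 hk).1) (by positivity)) (sq_nonneg _)
  exact .of_nonneg_of_le (fun j => by positivity) hblock ((summable_sum_Ico
    h.strictMono.monotone hw₀ ((summable_nat_add_iff 1).1 hsum)).mul_left _)

end IsBlockPartition

end BlockPartition

section MomentumPath

variable {E : Type*} [NormedAddCommGroup E] [InnerProductSpace ℝ E]

/-- The displacement of the last step before `x k`. At `k = 0` it is zero, because `0 - 1 = 0`. -/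
def velocity (x : ℕ → E) (k : ℕ) : E :=
  x k - x (k - 1)

/-- The point at which the momentum method with parameter `lam` would come to rest if from `x k` on
it were driven by its momentum alone. -/
noncomputable def averagedIterate (lam : ℝ) (x : ℕ → E) (k : ℕ) : E :=
  x k + (lam * (1 - lam)⁻¹) • velocity x k

theorem norm_sub_averagedIterate_le {x : ℕ → E} {lam : ℝ} (hlam0 : 0 ≤ lam) (hlam1 : lam < 1)
    (k l : ℕ) :
    ‖x k - averagedIterate lam x l‖ ≤
      (1 - lam)⁻¹ * (‖averagedIterate lam x k - averagedIterate lam x l‖ + ‖velocity x k‖) := by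
  have hinv : 1 ≤ (1 - lam)⁻¹ := (one_le_inv₀ (sub_pos.2 hlam1)).2 (by linarith)
  have heq : x k - averagedIterate lam x l =
      averagedIterate lam x k - averagedIterate lam x l -
        (lam * (1 - lam)⁻¹) • velocity x k := by
    simp only [averagedIterate]
    module
  calc ‖x k - averagedIterate lam x l‖
      ≤ ‖averagedIterate lam x k - averagedIterate lam x l‖ +
          lam * (1 - lam)⁻¹ * ‖velocity x k‖ := by
        rw [heq, ← norm_smul_of_nonneg (by positivity)]
        exact norm_sub_le _ _
    _ ≤ (1 - lam)⁻¹ * ‖averagedIterate lam x k - averagedIterate lam x l‖ +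
          1 * (1 - lam)⁻¹ * ‖velocity x k‖ := by
        gcongr
        exact le_mul_of_one_le_left (norm_nonneg _) hinv
    _ = _ := by ring

variable [CompleteSpace E]

/-- `x` is a single trajectory of the gradient method for `f` with momentum parameters `lam` and
`ν`, step sizes `α` and gradient errors `e`. -/
def IsMomentumPath (f : E → ℝ) (α : ℕ → ℝ) (lam ν : ℝ) (e x : ℕ → E) : Prop :=
  ∀ k, 1 ≤ k →
    x (k + 1) = x k - α k • (∇ f (x k + ν • velocity x k) - e k) + lam • velocity x k

variable {f : E → ℝ} {α : ℕ → ℝ} {lam ν τ δ p : ℝ} {L : ℝ≥0} {e x : ℕ → E} {m : ℕ → ℕ} {s : ℕ → ℝ}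

theorem IsMomentumPath.velocity_succ (hx : IsMomentumPath f α lam ν e x) {k : ℕ} (hk : 1 ≤ k) :
    velocity x (k + 1) = lam • velocity x k - α k • (∇ f (x k + ν • velocity x k) - e k) := by
  rw [velocity, Nat.add_sub_cancel, hx k hk]
  abel

theorem IsMomentumPath.averagedIterate_succ (hx : IsMomentumPath f α lam ν e x) (hlam : lam < 1)
    {k : ℕ} (hk : 1 ≤ k) :
    averagedIterate lam x (k + 1) = averagedIterate lam x k -
      (α k * (1 - lam)⁻¹) • (∇ f (x k + ν • velocity x k) - e k) := by
  have hlam' : 1 - lam ≠ 0 := (sub_pos.2 hlam).ne'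
  rw [averagedIterate, averagedIterate, hx.velocity_succ hk, hx k hk]
  match_scalars <;> field_simp <;> ring

theorem norm_gradient_sub_gradient_averagedIterate_le (hLip : LipschitzWith L (∇ f)) (k l : ℕ) :
    ‖∇ f (x k + ν • velocity x k) - ∇ f (averagedIterate lam x l)‖ ≤
      L * (‖averagedIterate lam x k - averagedIterate lam x l‖ +
        |ν - lam * (1 - lam)⁻¹| * ‖velocity x k‖) := by
  have heq : x k + ν • velocity x k - averagedIterate lam x l =
      averagedIterate lam x k - averagedIterate lam x l +
        (ν - lam * (1 - lam)⁻¹) • velocity x k := by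
    simp only [averagedIterate]
    module
  refine (hLip.norm_sub_le _ _).trans ?_
  rw [heq, ← Real.norm_eq_abs, ← norm_smul]
  gcongr
  exact norm_add_le _ _

/-- A common bound for the constants by which the smoothness of `f` and the momentum parameters
enter the analysis of a block. -/
noncomputable def momentumBound (L : ℝ≥0) (lam ν : ℝ) : ℝ :=
  (1 - lam)⁻¹ + L * (1 + |ν - lam * (1 - lam)⁻¹|)

/-- The constant in the estimates for one block of the momentum method. -/
noncomputable def blockConst (L : ℝ≥0) (lam ν : ℝ) : ℝ :=
  16 * momentumBound L lam ν ^ 5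

/-- Blocks of length `τ` are short enough for the estimates on a block, and steps of size at most
`δ` are so short that the momentum present at the start of a block has decayed at its end. -/
structure IsAdmissibleBlockSize (L : ℝ≥0) (lam ν τ δ : ℝ) : Prop where
  lam_nonneg : 0 ≤ lam
  lam_lt_one : lam < 1
  length_pos : 0 < τ
  step_pos : 0 < δ
  length_le : 200 * blockConst L lam ν ^ 3 * τ ≤ 1
  step_le : δ ≤ τ ^ 2
  pow_le : ∀ n : ℕ, τ ≤ n * δ → lam ^ n ≤ 1 / 4

theorem inv_le_momentumBound : (1 - lam)⁻¹ ≤ momentumBound L lam ν :=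
  le_add_of_nonneg_right (by positivity)

theorem lipschitz_le_momentumBound (hlam : lam < 1) : L ≤ momentumBound L lam ν :=
  le_add_of_nonneg_of_le (inv_nonneg.2 (sub_pos.2 hlam).le)
    (le_mul_of_one_le_right L.coe_nonneg (le_add_of_nonneg_right (abs_nonneg _)))

theorem lipschitz_mul_abs_le_momentumBound (hlam : lam < 1) :
    L * |ν - lam * (1 - lam)⁻¹| ≤ momentumBound L lam ν :=
  le_add_of_nonneg_of_le (inv_nonneg.2 (sub_pos.2 hlam).le)
    (mul_le_mul_of_nonneg_left (le_add_of_nonneg_left zero_le_one) L.coe_nonneg)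

theorem blockConst_pos (hlam : lam < 1) : 0 < blockConst L lam ν := by
  have := sub_pos.2 hlam
  rw [blockConst, momentumBound]
  positivity

theorem exists_isAdmissibleBlockSize (hlam0 : 0 ≤ lam) (hlam1 : lam < 1) :
    ∃ τ δ, IsAdmissibleBlockSize L lam ν τ δ := by
  have hK : 0 < blockConst L lam ν := blockConst_pos hlam1
  obtain ⟨N, hN⟩ := exists_pow_lt_of_lt_one (by norm_num : (0 : ℝ) < 1 / 4) hlam1
  set τ := (200 * blockConst L lam ν ^ 3)⁻¹
  have hτ₀ : 0 < τ := by positivity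
  refine ⟨τ, min (τ ^ 2) (τ / (N + 1)), hlam0, hlam1, hτ₀, by positivity,
    (mul_inv_cancel₀ (by positivity)).le, min_le_left _ _, fun n hn => ?_⟩
  have hle : τ ≤ n * (τ / (N + 1)) := hn.trans (by gcongr; exact min_le_right _ _)
  have hNn : N ≤ n := by
    rw [mul_div_left_comm, le_mul_iff_one_le_right hτ₀, one_le_div₀ (by positivity)] at hle
    exact_mod_cast (lt_add_one (N : ℝ)).le.trans hle
  exact (pow_le_pow_of_le_one hlam0 hlam1.le hNn).trans hN.le

namespace IsAdmissibleBlockSize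

theorem one_le_momentumBound (h : IsAdmissibleBlockSize L lam ν τ δ) :
    1 ≤ momentumBound L lam ν :=
  ((one_le_inv₀ (sub_pos.2 h.lam_lt_one)).2 (by linarith [h.lam_nonneg])).trans
    inv_le_momentumBound

theorem momentumBound_le_blockConst (h : IsAdmissibleBlockSize L lam ν τ δ) :
    momentumBound L lam ν ≤ blockConst L lam ν := by
  have hpow : momentumBound L lam ν ≤ momentumBound L lam ν ^ 5 :=
    le_self_pow₀ h.one_le_momentumBound (by norm_num)
  rw [blockConst]
  linarith [h.one_le_momentumBound]

theorem one_le_blockConst (h : IsAdmissibleBlockSize L lam ν τ δ) : 1 ≤ blockConst L lam ν :=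
  h.one_le_momentumBound.trans h.momentumBound_le_blockConst

theorem blockConst_le (h : IsAdmissibleBlockSize L lam ν τ δ) :
    blockConst L lam ν ≤ 6 * blockConst L lam ν ^ 2 / τ := by
  have hK := h.one_le_blockConst
  have hτ : τ ≤ 1 := by
    nlinarith [h.length_le, mul_nonneg h.length_pos.le (sub_nonneg.2 (one_le_pow₀ hK (n := 3)))]
  rw [le_div_iff₀ h.length_pos]
  nlinarith

theorem mul_sum_le (h : IsAdmissibleBlockSize L lam ν τ δ) (hm : IsBlockPartition α τ δ m)
    (j : ℕ) :
    100 * blockConst L lam ν ^ 3 * ∑ k ∈ Finset.Ico (m j) (m (j + 1)), α k ≤ 1 := by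
  have hK : 0 ≤ blockConst L lam ν := zero_le_one.trans h.one_le_blockConst
  calc 100 * blockConst L lam ν ^ 3 * ∑ k ∈ Finset.Ico (m j) (m (j + 1)), α k
      ≤ 100 * blockConst L lam ν ^ 3 * (2 * τ) := by
        gcongr
        exact hm.sum_le j
    _ = 200 * blockConst L lam ν ^ 3 * τ := by ring
    _ ≤ 1 := h.length_le

theorem isMomentumBlock (h : IsAdmissibleBlockSize L lam ν τ δ) (hm : IsBlockPartition α τ δ m)
    (hx : IsMomentumPath f α lam ν e x) (hLip : LipschitzWith L (∇ f)) {j : ℕ} {σ : ℝ}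
    (hσ : ∀ i ≤ m (j + 1) - m j, ‖∑ l ∈ Finset.range i, α (m j + l) • e (m j + l)‖ ≤ σ) :
    IsMomentumBlock lam (momentumBound L lam ν) (∑ k ∈ Finset.Ico (m j) (m (j + 1)), α k) σ
      (m (j + 1) - m j) (fun l => α (m j + l))
      (fun l => ∇ f (x (m j + l) + ν • velocity x (m j + l))) (fun l => e (m j + l))
      (fun l => averagedIterate lam x (m j + l)) (fun l => velocity x (m j + l))
      (∇ f (averagedIterate lam x (m j))) where
  lam_nonneg := h.lam_nonneg
  lam_lt_one := h.lam_lt_one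
  inv_le := inv_le_momentumBound
  length_le := by
    have hB := h.one_le_momentumBound
    have hT : 0 ≤ ∑ k ∈ Finset.Ico (m j) (m (j + 1)), α k := h.length_pos.le.trans (hm.le_sum j)
    refine le_trans ?_ (h.mul_sum_le hm j)
    gcongr ?_ * ?_ * _
    · norm_num
    · exact (pow_le_pow_left₀ (by positivity) h.momentumBound_le_blockConst 2).trans
        (pow_le_pow_right₀ h.one_le_blockConst (by norm_num))
  step_nonneg i _ := hm.step_nonneg _ (hm.start_le_add j i)
  step_le i _ := (hm.step_le _ (hm.start_le_add j i)).trans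
    (h.step_le.trans (pow_le_pow_left₀ h.length_pos.le (hm.le_sum j) 2))
  sum_step := (Finset.sum_Ico_eq_sum_range α _ _).symm
  norm_noise_le := hσ
  velocity_succ i _ := hx.velocity_succ (hm.one_le_start.trans (hm.start_le_add j i))
  averaged_succ i _ :=
    hx.averagedIterate_succ h.lam_lt_one (hm.one_le_start.trans (hm.start_le_add j i))
  norm_gradient_sub_le i _ := by
    refine (norm_gradient_sub_gradient_averagedIterate_le hLip _ _).trans ?_
    rw [mul_add, mul_add, ← mul_assoc]
    exact add_le_add
      (mul_le_mul_of_nonneg_right (lipschitz_le_momentumBound h.lam_lt_one) (norm_nonneg _))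
      (mul_le_mul_of_nonneg_right (lipschitz_mul_abs_le_momentumBound h.lam_lt_one)
        (norm_nonneg _))

theorem lyapunov_decrease_block (h : IsAdmissibleBlockSize L lam ν τ δ)
    (hm : IsBlockPartition α τ δ m) (hx : IsMomentumPath f α lam ν e x) (hf : Differentiable ℝ f)
    (hLip : LipschitzWith L (∇ f)) {j : ℕ} {σ : ℝ}
    (hσ : ∀ i ≤ m (j + 1) - m j, ‖∑ l ∈ Finset.range i, α (m j + l) • e (m j + l)‖ ≤ σ) :
    f (averagedIterate lam x (m (j + 1))) + ‖velocity x (m (j + 1))‖ ^ 2 ≤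
      f (averagedIterate lam x (m j)) + ‖velocity x (m j)‖ ^ 2
        - τ / 2 * (‖∇ f (averagedIterate lam x (m j))‖ ^ 2 + ‖velocity x (m j)‖ ^ 2)
        + 6 * blockConst L lam ν ^ 2 / τ * σ ^ 2 := by
  have hblock := h.isMomentumBlock hm hx hLip hσ
  have hone := sub_pos.2 h.lam_lt_one
  have hτT := hm.le_sum j
  have hT : 0 < ∑ k ∈ Finset.Ico (m j) (m (j + 1)), α k := h.length_pos.trans_le hτT
  have hstep := hblock.norm_averaged_sub_add_smul_le
  have hvel := hblock.norm_velocity_last_le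
  simp only [hm.add_length, add_zero] at hstep hvel
  rw [← blockConst] at hstep hvel
  have hdescent := le_of_norm_sub_add_smul_gradient_le hf hLip (by positivity) hstep
  have hdecay : lam ^ (m (j + 1) - m j) * ‖velocity x (m j)‖ ≤ ‖velocity x (m j)‖ / 4 := by
    linarith [mul_le_mul_of_nonneg_right (h.pow_le _ (hm.le_length_mul j))
      (norm_nonneg (velocity x (m j)))]
  refine (lyapunov_decrease hT ((one_le_inv₀ hone).2 (by linarith [h.lam_nonneg]))
    (inv_le_momentumBound.trans h.momentumBound_le_blockConst)
    ((lipschitz_le_momentumBound h.lam_lt_one).trans h.momentumBound_le_blockConst)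
    (h.mul_sum_le hm j) (norm_nonneg _) (norm_nonneg _) hblock.noise_nonneg (norm_nonneg _)
    (hvel.trans (by gcongr)) hdescent).trans ?_
  have hτ := h.length_pos
  gcongr

theorem isInexactDescent (h : IsAdmissibleBlockSize L lam ν τ δ) (hm : IsBlockPartition α τ δ m)
    (hx : IsMomentumPath f α lam ν e x) (hf : Differentiable ℝ f) (hLip : LipschitzWith L (∇ f))
    (hs : ∀ j, ∀ i ≤ m (j + 1) - m j,
      ‖∑ l ∈ Finset.range i, α (m j + l) • e (m j + l)‖ ≤ s j)
    (hp : 1 < p) (hsum : Summable fun j : ℕ => ((j : ℝ) + 1) ^ p * s j ^ 2) :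
    IsInexactDescent f p (τ / 2) (6 * blockConst L lam ν ^ 2 / τ)
      (fun j => averagedIterate lam x (m j)) (fun j => ‖velocity x (m j)‖) s where
  one_lt_exponent := hp
  rate_pos := half_pos h.length_pos
  const_pos := (zero_lt_one.trans_le h.one_le_blockConst).trans_le h.blockConst_le
  momentum_nonneg _ := norm_nonneg _
  error_nonneg j := (h.isMomentumBlock hm hx hLip (hs j)).noise_nonneg
  summable_error := hsum
  decrease j := h.lyapunov_decrease_block hm hx hf hLip (hs j)
  norm_sub_le j := by
    have hblock := h.isMomentumBlock hm hx hLip (hs j)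
    have hnoise := hblock.noise_nonneg
    have hle := hblock.norm_averaged_sub_add_norm_velocity_le le_rfl
    simp only [hm.add_length, add_zero] at hle
    rw [← blockConst] at hle
    refine (le_add_of_nonneg_right (norm_nonneg _)).trans (hle.trans ?_)
    gcongr
    exact h.blockConst_le

theorem norm_sub_averagedIterate_block_le (h : IsAdmissibleBlockSize L lam ν τ δ)
    (hm : IsBlockPartition α τ δ m) (hx : IsMomentumPath f α lam ν e x)
    (hLip : LipschitzWith L (∇ f)) {j k : ℕ} {σ : ℝ}
    (hσ : ∀ i ≤ m (j + 1) - m j, ‖∑ l ∈ Finset.range i, α (m j + l) • e (m j + l)‖ ≤ σ)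
    (hjk : m j ≤ k) (hkj : k ≤ m (j + 1)) :
    ‖x k - averagedIterate lam x (m j)‖ ≤ (1 - lam)⁻¹ * (blockConst L lam ν *
      (‖∇ f (averagedIterate lam x (m j))‖ + ‖velocity x (m j)‖ + σ)) := by
  have hle := (h.isMomentumBlock hm hx hLip hσ).norm_averaged_sub_add_norm_velocity_le
    (Nat.sub_le_sub_right hkj (m j))
  simp only [Nat.add_sub_of_le hjk, add_zero] at hle
  rw [← blockConst] at hle
  have hone := sub_pos.2 h.lam_lt_one
  refine (norm_sub_averagedIterate_le h.lam_nonneg h.lam_lt_one k (m j)).trans ?_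
  gcongr

theorem tendsto_norm_atTop_or_tendsto [ProperSpace E] (h : IsAdmissibleBlockSize L lam ν τ δ)
    (hm : IsBlockPartition α τ δ m) (hx : IsMomentumPath f α lam ν e x)
    (hf : Differentiable ℝ f) (hbdd : ∃ B, ∀ y, B ≤ f y) (hLip : LipschitzWith L (∇ f))
    (hloj : ∀ z, ∇ f z = 0 → ∃ θ < 1, HasLojasiewiczExponent f z θ)
    (hs : ∀ j, ∀ i ≤ m (j + 1) - m j,
      ‖∑ l ∈ Finset.range i, α (m j + l) • e (m j + l)‖ ≤ s j)
    (hp : 1 < p) (hsum : Summable fun j : ℕ => ((j : ℝ) + 1) ^ p * s j ^ 2) :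
    Tendsto (fun k => ‖x k‖) atTop atTop ∨ ∃ z, ∇ f z = 0 ∧ Tendsto x atTop (𝓝 z) := by
  have hdesc := h.isInexactDescent hm hx hf hLip hs hp hsum
  obtain ⟨J, hJ, hJm⟩ := exists_tendsto_block_index hm.strictMono
  have hdiff : Tendsto (fun k => x k - averagedIterate lam x (m (J k))) atTop (𝓝 0) := by
    have hbound := (((((hdesc.tendsto_norm_gradient hbdd).add (hdesc.tendsto_momentum hbdd)).add
      hdesc.tendsto_error).const_mul (blockConst L lam ν)).const_mul (1 - lam)⁻¹).comp hJ
    simp only [add_zero, mul_zero] at hbound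
    refine squeeze_zero_norm' ?_ hbound
    filter_upwards [eventually_ge_atTop (m 0)] with k hk
    exact h.norm_sub_averagedIterate_block_le hm hx hLip (hs (J k)) (hJm k hk).1 (hJm k hk).2.le
  rcases hdesc.tendsto_norm_atTop_or_tendsto hbdd hf.continuous hLip.continuous hloj with
    hinfty | ⟨z, hz, hlim⟩
  · refine .inl (tendsto_atTop_mono (fun k => ?_) ((hinfty.comp hJ).atTop_add hdiff.norm.neg))
    have := norm_sub_norm_le (averagedIterate lam x (m (J k))) (x k)
    rw [norm_sub_rev] at this
    simp only [Function.comp_apply]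
    linarith
  · exact .inr ⟨z, hz, by simpa using hdiff.add (hlim.comp hJ)⟩

end IsAdmissibleBlockSize

end MomentumPath

section MaximalInequality

variable {F : Type*} [NormedAddCommGroup F]

/-- The largest norm of the partial sums of `v` with at most `n` terms. -/
noncomputable def maxNormPartialSum (v : ℕ → F) (n : ℕ) : ℝ :=
  partialSups (fun i => ‖∑ l ∈ Finset.range i, v l‖) n

theorem maxNormPartialSum_zero (v : ℕ → F) : maxNormPartialSum v 0 = 0 := by
  simp [maxNormPartialSum]

theorem maxNormPartialSum_succ (v : ℕ → F) (n : ℕ) :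
    maxNormPartialSum v (n + 1) =
      max (maxNormPartialSum v n) ‖∑ l ∈ Finset.range (n + 1), v l‖ :=
  partialSups_succ _ n

theorem norm_sum_range_le_maxNormPartialSum (v : ℕ → F) {i n : ℕ} (h : i ≤ n) :
    ‖∑ l ∈ Finset.range i, v l‖ ≤ maxNormPartialSum v n :=
  le_partialSups_of_le (fun i => ‖∑ l ∈ Finset.range i, v l‖) h

theorem maxNormPartialSum_nonneg (v : ℕ → F) (n : ℕ) : 0 ≤ maxNormPartialSum v n :=
  (norm_nonneg _).trans (norm_sum_range_le_maxNormPartialSum v n.zero_le)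

variable [InnerProductSpace ℝ F]

/-- The integrand at step `k` of the discrete stochastic integral in the pathwise form of Doob's
`L²` inequality: the normalized `k`-th partial sum of `v`, or zero if that partial sum vanishes,
scaled by the running maximum. It only depends on `v l` for `l < k`. -/
noncomputable def doobMultiplier (v : ℕ → F) (k : ℕ) : F :=
  (maxNormPartialSum v k * ‖∑ l ∈ Finset.range k, v l‖⁻¹) • ∑ l ∈ Finset.range k, v l

theorem norm_doobMultiplier_le (v : ℕ → F) (k : ℕ) :
    ‖doobMultiplier v k‖ ≤ maxNormPartialSum v k := by
  have hmax := maxNormPartialSum_nonneg v k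
  rw [doobMultiplier, norm_smul_of_nonneg (by positivity), mul_assoc]
  exact mul_le_of_le_one_right hmax inv_mul_le_one

theorem norm_add_inner_inv_norm_smul_le (u v : F) :
    ‖u‖ + inner ℝ (‖u‖⁻¹ • u) v ≤ ‖u + v‖ := by
  calc ‖u‖ + inner ℝ (‖u‖⁻¹ • u) v = inner ℝ (‖u‖⁻¹ • u) (u + v) := by
        rw [inner_add_right, real_inner_smul_left u u, real_inner_self_eq_norm_mul_norm,
          ← mul_assoc, inv_mul_mul_self]
    _ ≤ ‖‖u‖⁻¹ • u‖ * ‖u + v‖ := real_inner_le_norm _ _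
    _ ≤ ‖u + v‖ := by
        rw [norm_smul, norm_inv, norm_norm]
        exact mul_le_of_le_one_left (norm_nonneg _) inv_mul_le_one

theorem inner_doobMultiplier_le (v : ℕ → F) (k : ℕ) :
    inner ℝ (doobMultiplier v k) (v k) ≤ maxNormPartialSum v k *
      (‖∑ l ∈ Finset.range (k + 1), v l‖ - ‖∑ l ∈ Finset.range k, v l‖) := by
  rw [Finset.sum_range_succ, doobMultiplier, mul_smul, real_inner_smul_left]
  refine mul_le_mul_of_nonneg_left ?_ (maxNormPartialSum_nonneg v k)
  exact le_sub_iff_add_le'.2 (norm_add_inner_inv_norm_smul_le _ _)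

theorem two_mul_sum_inner_doobMultiplier_le (v : ℕ → F) (n : ℕ) :
    2 * ∑ k ∈ Finset.range n, inner ℝ (doobMultiplier v k) (v k) ≤
      2 * maxNormPartialSum v n * ‖∑ l ∈ Finset.range n, v l‖ - maxNormPartialSum v n ^ 2 := by
  induction n with
  | zero => simp [maxNormPartialSum_zero]
  | succ n ih =>
    have hinner := inner_doobMultiplier_le v n
    have hmax : 2 * maxNormPartialSum v n * ‖∑ l ∈ Finset.range (n + 1), v l‖ -
          maxNormPartialSum v n ^ 2 ≤
        2 * maxNormPartialSum v (n + 1) * ‖∑ l ∈ Finset.range (n + 1), v l‖ -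
          maxNormPartialSum v (n + 1) ^ 2 := by
      rw [maxNormPartialSum_succ]
      rcases max_choice (maxNormPartialSum v n) ‖∑ l ∈ Finset.range (n + 1), v l‖ with h | h
      · rw [h]
      · rw [h]
        nlinarith [sq_nonneg (maxNormPartialSum v n - ‖∑ l ∈ Finset.range (n + 1), v l‖)]
    rw [Finset.sum_range_succ]
    linarith

theorem maxNormPartialSum_sq_le (v : ℕ → F) (n : ℕ) :
    maxNormPartialSum v n ^ 2 ≤ 4 * ‖∑ l ∈ Finset.range n, v l‖ ^ 2 -
      4 * ∑ k ∈ Finset.range n, inner ℝ (doobMultiplier v k) (v k) := by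
  nlinarith [two_mul_sum_inner_doobMultiplier_le v n,
    sq_nonneg (maxNormPartialSum v n - 2 * ‖∑ l ∈ Finset.range n, v l‖)]

end MaximalInequality

section MartingaleDifference

variable {F : Type*} [NormedAddCommGroup F] {Ω : Type*} {mΩ : MeasurableSpace Ω}

theorem stronglyMeasurable_maxNormPartialSum {v : ℕ → Ω → F} {n : ℕ}
    (hv : ∀ l < n, StronglyMeasurable (v l)) :
    StronglyMeasurable fun ω => maxNormPartialSum (fun l => v l ω) n := by
  induction n with
  | zero => simpa only [maxNormPartialSum_zero] using stronglyMeasurable_const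
  | succ n ih =>
    have hsum : StronglyMeasurable fun ω => ∑ l ∈ Finset.range (n + 1), v l ω :=
      Finset.stronglyMeasurable_fun_sum _ fun l hl => hv l (Finset.mem_range.1 hl)
    simp only [maxNormPartialSum_succ]
    exact (ih fun l hl => hv l (hl.trans n.lt_succ_self)).sup hsum.norm

variable {μ : Measure Ω}

theorem memLp_maxNormPartialSum {v : ℕ → Ω → F} {p : ENNReal} (hv : ∀ l, MemLp (v l) p μ) (n : ℕ) :
    MemLp (fun ω => maxNormPartialSum (fun l => v l ω) n) p μ := by
  induction n with
  | zero => simp only [maxNormPartialSum_zero, MemLp.zero']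
  | succ n ih =>
    simp only [maxNormPartialSum_succ]
    exact ih.sup (memLp_finsetSum _ fun l _ => hv l).norm

variable [InnerProductSpace ℝ F]

theorem stronglyMeasurable_doobMultiplier {v : ℕ → Ω → F} {n : ℕ}
    (hv : ∀ l < n, StronglyMeasurable (v l)) :
    StronglyMeasurable fun ω => doobMultiplier (fun l => v l ω) n := by
  have hsum : StronglyMeasurable fun ω => ∑ l ∈ Finset.range n, v l ω :=
    Finset.stronglyMeasurable_fun_sum _ fun l hl => hv l (Finset.mem_range.1 hl)
  exact ((stronglyMeasurable_maxNormPartialSum hv).mul hsum.norm.inv₀).smul hsum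

theorem integrable_inner_of_memLp_two {g v : Ω → F} (hg : MemLp g 2 μ) (hv : MemLp v 2 μ) :
    Integrable (fun ω => inner ℝ (g ω) (v ω)) μ :=
  (hg.norm.integrable_mul hv.norm).mono' (hg.1.inner hv.1)
    (ae_of_all _ fun ω => norm_inner_le_norm (g ω) (v ω))

theorem integral_inner_eq_zero_of_condExp_eq_zero [CompleteSpace F] [IsFiniteMeasure μ]
    {m : MeasurableSpace Ω} (hm : m ≤ mΩ) {g v : Ω → F} (hgm : StronglyMeasurable[m] g)
    (hg : MemLp g 2 μ) (hv : MemLp v 2 μ) (hcond : μ[v | m] =ᵐ[μ] 0) :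
    ∫ ω, inner ℝ (g ω) (v ω) ∂μ = 0 := by
  have hpull := condExp_bilin_of_stronglyMeasurable_left (innerSL ℝ) hgm
    (integrable_inner_of_memLp_two hg hv) (hv.integrable one_le_two)
  refine (integral_condExp hm).symm.trans (integral_eq_zero_of_ae ?_)
  filter_upwards [hpull, hcond] with ω hpullω hcondω
  refine hpullω.trans ?_
  simp [hcondω]

/-- From time `a` on, `v` is a square integrable martingale difference sequence. The increment `v k`
belongs to the step from time `k` to time `k + 1`: it is known at time `k + 1` and centred given
`ℱ k`. -/
structure IsMartingaleDifferenceFrom (ℱ : Filtration ℕ mΩ) (a : ℕ) (v : ℕ → Ω → F)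
    (μ : Measure Ω) : Prop where
  memLp : ∀ k, a ≤ k → MemLp (v k) 2 μ
  stronglyMeasurable : ∀ k, a ≤ k → StronglyMeasurable[ℱ (k + 1)] (v k)
  condExp_eq_zero : ∀ k, a ≤ k → μ[v k | ℱ k] =ᵐ[μ] 0

variable {ℱ : Filtration ℕ mΩ} {a b n : ℕ} {v : ℕ → Ω → F} {C : ℝ}

namespace IsMartingaleDifferenceFrom

theorem mono (h : IsMartingaleDifferenceFrom ℱ a v μ) (hab : a ≤ b) :
    IsMartingaleDifferenceFrom ℱ b v μ where
  memLp k hk := h.memLp k (hab.trans hk)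
  stronglyMeasurable k hk := h.stronglyMeasurable k (hab.trans hk)
  condExp_eq_zero k hk := h.condExp_eq_zero k (hab.trans hk)

theorem memLp_add (h : IsMartingaleDifferenceFrom ℱ a v μ) (l : ℕ) : MemLp (v (a + l)) 2 μ :=
  h.memLp _ (Nat.le_add_right a l)

theorem stronglyMeasurable_add (h : IsMartingaleDifferenceFrom ℱ a v μ) (n l : ℕ) (hl : l < n) :
    StronglyMeasurable[ℱ (a + n)] (v (a + l)) :=
  (h.stronglyMeasurable _ (Nat.le_add_right a l)).mono (ℱ.mono (by omega))

theorem memLp_doobMultiplier (h : IsMartingaleDifferenceFrom ℱ a v μ) (n : ℕ) :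
    MemLp (fun ω => doobMultiplier (fun l => v (a + l) ω) n) 2 μ :=
  (memLp_maxNormPartialSum h.memLp_add n).of_le
    ((stronglyMeasurable_doobMultiplier (h.stronglyMeasurable_add n)).mono
      (ℱ.le _)).aestronglyMeasurable
    (ae_of_all _ fun _ => (norm_doobMultiplier_le _ n).trans (Real.le_norm_self _))

variable [CompleteSpace F]

theorem const_smul (h : IsMartingaleDifferenceFrom ℱ a v μ) (c : ℕ → ℝ) :
    IsMartingaleDifferenceFrom ℱ a (fun k => c k • v k) μ where
  memLp k hk := (h.memLp k hk).const_smul (c k)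
  stronglyMeasurable k hk := (h.stronglyMeasurable k hk).const_smul (c k)
  condExp_eq_zero k hk := by
    filter_upwards [condExp_smul (c k) (v k) (ℱ k), h.condExp_eq_zero k hk] with ω hsmul hzero
    rw [hsmul, Pi.smul_apply, hzero, Pi.zero_apply, smul_zero]

variable [IsFiniteMeasure μ]

theorem integral_inner_eq_zero (h : IsMartingaleDifferenceFrom ℱ a v μ) {g : Ω → F}
    (hgm : StronglyMeasurable[ℱ (a + n)] g) (hg : MemLp g 2 μ) :
    ∫ ω, inner ℝ (g ω) (v (a + n) ω) ∂μ = 0 :=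
  integral_inner_eq_zero_of_condExp_eq_zero (ℱ.le _) hgm hg (h.memLp_add n)
    (h.condExp_eq_zero _ (Nat.le_add_right a n))

theorem integral_norm_sum_sq (h : IsMartingaleDifferenceFrom ℱ a v μ) (n : ℕ) :
    ∫ ω, ‖∑ l ∈ Finset.range n, v (a + l) ω‖ ^ 2 ∂μ =
      ∑ l ∈ Finset.range n, ∫ ω, ‖v (a + l) ω‖ ^ 2 ∂μ := by
  induction n with
  | zero => simp
  | succ n ih =>
    have hS : MemLp (fun ω => ∑ l ∈ Finset.range n, v (a + l) ω) 2 μ :=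
      memLp_finsetSum _ fun l _ => h.memLp_add l
    have hSm : StronglyMeasurable[ℱ (a + n)] fun ω => ∑ l ∈ Finset.range n, v (a + l) ω :=
      Finset.stronglyMeasurable_fun_sum _ fun l hl =>
        h.stronglyMeasurable_add n l (Finset.mem_range.1 hl)
    have hinner := (integrable_inner_of_memLp_two hS (h.memLp_add n)).const_mul 2
    simp only [Finset.sum_range_succ, norm_add_sq_real]
    rw [integral_add (hS.norm.integrable_sq.fun_add hinner) (h.memLp_add n).norm.integrable_sq,
      integral_add hS.norm.integrable_sq hinner, integral_const_mul,
      h.integral_inner_eq_zero hSm hS, ih, mul_zero, add_zero]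

theorem integral_maxNormPartialSum_sq_le (h : IsMartingaleDifferenceFrom ℱ a v μ) (n : ℕ) :
    ∫ ω, maxNormPartialSum (fun l => v (a + l) ω) n ^ 2 ∂μ ≤
      4 * ∑ l ∈ Finset.range n, ∫ ω, ‖v (a + l) ω‖ ^ 2 ∂μ := by
  have hS : MemLp (fun ω => ∑ l ∈ Finset.range n, v (a + l) ω) 2 μ :=
    memLp_finsetSum _ fun l _ => h.memLp_add l
  have hS' := hS.norm.integrable_sq.const_mul 4
  have hinner : ∀ k ∈ Finset.range n,
      Integrable (fun ω => inner ℝ (doobMultiplier (fun l => v (a + l) ω) k) (v (a + k) ω)) μ :=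
    fun k _ => integrable_inner_of_memLp_two (h.memLp_doobMultiplier k) (h.memLp_add k)
  have hinner' := (integrable_finsetSum _ hinner).const_mul 4
  have hzero : ∀ k ∈ Finset.range n,
      ∫ ω, inner ℝ (doobMultiplier (fun l => v (a + l) ω) k) (v (a + k) ω) ∂μ = 0 := fun k _ =>
    h.integral_inner_eq_zero (stronglyMeasurable_doobMultiplier (h.stronglyMeasurable_add k))
      (h.memLp_doobMultiplier k)
  calc ∫ ω, maxNormPartialSum (fun l => v (a + l) ω) n ^ 2 ∂μ
      ≤ ∫ ω, (4 * ‖∑ l ∈ Finset.range n, v (a + l) ω‖ ^ 2 - 4 * ∑ k ∈ Finset.range n,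
          inner ℝ (doobMultiplier (fun l => v (a + l) ω) k) (v (a + k) ω)) ∂μ :=
        integral_mono (memLp_maxNormPartialSum h.memLp_add n).integrable_sq (hS'.sub hinner')
          fun ω => maxNormPartialSum_sq_le (fun l => v (a + l) ω) n
    _ = 4 * ∑ l ∈ Finset.range n, ∫ ω, ‖v (a + l) ω‖ ^ 2 ∂μ := by
        rw [integral_sub hS' hinner', integral_const_mul, integral_const_mul,
          h.integral_norm_sum_sq, integral_finsetSum _ hinner, Finset.sum_eq_zero hzero,
          mul_zero, sub_zero]

theorem integral_maxNormPartialSum_smul_sq_le (h : IsMartingaleDifferenceFrom ℱ a v μ)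
    (hC : ∀ k, a ≤ k → ∫ ω, ‖v k ω‖ ^ 2 ∂μ ≤ C) (c : ℕ → ℝ) (hab : a ≤ b) (n : ℕ) :
    ∫ ω, maxNormPartialSum (fun l => c (b + l) • v (b + l) ω) n ^ 2 ∂μ ≤
      4 * C * ∑ l ∈ Finset.range n, c (b + l) ^ 2 := by
  refine (((h.mono hab).const_smul c).integral_maxNormPartialSum_sq_le n).trans ?_
  rw [mul_assoc, Finset.mul_sum _ _ C]
  gcongr with l
  calc ∫ ω, ‖c (b + l) • v (b + l) ω‖ ^ 2 ∂μ = c (b + l) ^ 2 * ∫ ω, ‖v (b + l) ω‖ ^ 2 ∂μ := by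
        simp only [norm_smul, mul_pow, Real.norm_eq_abs, sq_abs, integral_const_mul]
    _ ≤ C * c (b + l) ^ 2 := by
        rw [mul_comm]
        gcongr
        exact hC _ (hab.trans (Nat.le_add_right b l))

end IsMartingaleDifferenceFrom

theorem ae_summable_of_summable_integral {X : ℕ → Ω → ℝ} (hX : ∀ j ω, 0 ≤ X j ω)
    (hint : ∀ j, Integrable (X j) μ) (hsum : Summable fun j => ∫ ω, X j ω ∂μ) :
    ∀ᵐ ω ∂μ, Summable fun j => X j ω := by
  have hnorm : ∀ j, eLpNorm (X j) 1 μ = ENNReal.ofReal (∫ ω, X j ω ∂μ) := fun j => by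
    rw [eLpNorm_one_eq_lintegral_enorm,
      ofReal_integral_eq_lintegral_ofReal (hint j) (ae_of_all _ (hX j))]
    exact lintegral_congr fun ω => Real.enorm_of_nonneg (hX j ω)
  have hfin : ∑' j, eLpNorm (X j) 1 μ ≠ ⊤ := by
    simp only [hnorm, ← ENNReal.ofReal_tsum_of_nonneg (fun j => integral_nonneg (hX j)) hsum]
    exact ENNReal.ofReal_ne_top
  filter_upwards [summable_norm_of_tsum_eLpNorm_ne_top le_rfl (fun j => (hint j).1) hfin]
    with ω hω
  exact hω.of_norm

theorem IsBlockPartition.ae_summable_rpow_mul_maxNormPartialSum_sq [CompleteSpace F]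
    [IsFiniteMeasure μ] {α : ℕ → ℝ} {τ δ r : ℝ} {m : ℕ → ℕ} (hm : IsBlockPartition α τ δ m)
    (hτ : 0 < τ) (hα : ∀ k, 1 ≤ k → 0 < α k) (hr : 0 ≤ r)
    (hsum : Summable fun k : ℕ =>
      α (k + 1) ^ 2 * (∑ i ∈ Finset.Icc 1 (k + 1), α i) ^ (2 * r))
    (hv : IsMartingaleDifferenceFrom ℱ 1 v μ) (hC : ∀ k, 1 ≤ k → ∫ ω, ‖v k ω‖ ^ 2 ∂μ ≤ C) :
    ∀ᵐ ω ∂μ, Summable fun j : ℕ => ((j : ℝ) + 1) ^ (2 * r) *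
      maxNormPartialSum (fun l => α (m j + l) • v (m j + l) ω) (m (j + 1) - m j) ^ 2 := by
  have hstart : ∀ j, 1 ≤ m j := fun j =>
    hm.one_le_start.trans (hm.strictMono.monotone j.zero_le)
  refine ae_summable_of_summable_integral (fun j ω => by positivity) (fun j =>
    (memLp_maxNormPartialSum
      ((hv.mono (hstart j)).const_smul α).memLp_add _).integrable_sq.const_mul _) ?_
  refine ((hm.summable_rpow_mul_sum_sq hτ hα hr hsum).mul_left (4 * C)).of_nonneg_of_le
    (fun j => integral_nonneg fun ω => by positivity) fun j => ?_
  rw [integral_const_mul, mul_left_comm, Finset.sum_Ico_eq_sum_range]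
  gcongr
  exact hv.integral_maxNormPartialSum_smul_sq_le hC α (hstart j) _

end MartingaleDifference

section Convergence

variable {E : Type*} [NormedAddCommGroup E] [InnerProductSpace ℝ E] [CompleteSpace E]
  {Ω : Type*} {mΩ : MeasurableSpace Ω} {f : E → ℝ} {α : ℕ → ℝ} {lam ν : ℝ} {e x : ℕ → Ω → E}
  {k : ℕ}

theorem IsMomentumPath.error_eq {e x : ℕ → E} (hx : IsMomentumPath f α lam ν e x) (hk : 1 ≤ k)
    (hα : α k ≠ 0) :
    e k = (α k)⁻¹ • (x (k + 1) - x k - lam • velocity x k) + ∇ f (x k + ν • velocity x k) := by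
  rw [hx k hk]
  match_scalars <;> field_simp <;> ring

theorem stronglyMeasurable_error {ℱ : Filtration ℕ mΩ} (hxℱ : StronglyAdapted ℱ x)
    (hx : ∀ ω, IsMomentumPath f α lam ν (fun k => e k ω) fun k => x k ω)
    (hf : Continuous (∇ f)) (hk : 1 ≤ k) (hα : α k ≠ 0) : StronglyMeasurable[ℱ (k + 1)] (e k) := by
  have hxk : ∀ i ≤ k + 1, StronglyMeasurable[ℱ (k + 1)] (x i) := fun i hi =>
    (hxℱ i).mono (ℱ.mono hi)
  have hvel : StronglyMeasurable[ℱ (k + 1)] fun ω => velocity (fun i => x i ω) k :=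
    (hxk k k.le_succ).sub (hxk (k - 1) (by omega))
  rw [(funext fun ω => (hx ω).error_eq hk hα : e k = _)]
  exact ((((hxk _ le_rfl).sub (hxk k k.le_succ)).sub (hvel.const_smul lam)).const_smul _).add
    (hf.comp_stronglyMeasurable ((hxk k k.le_succ).add (hvel.const_smul ν)))

end Convergence

theorem NoiseAssumption.integral_norm_sq_le {d : ℕ} {Ω : Type*} [MeasurableSpace Ω]
    {μ : Measure Ω} [IsProbabilityMeasure μ] {x : ℕ → Ω → EuclideanSpace ℝ (Fin d)}
    {hx : ∀ k, StronglyMeasurable (x k)} {e : ℕ → Ω → EuclideanSpace ℝ (Fin d)} {σ : ℝ}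
    (h : NoiseAssumption μ x hx e σ) {k : ℕ} (hk : 1 ≤ k) : ∫ ω, ‖e k ω‖ ^ 2 ∂μ ≤ σ ^ 2 := by
  calc ∫ ω, ‖e k ω‖ ^ 2 ∂μ
      = ∫ ω, (μ[fun ω => ‖e k ω‖ ^ 2 | Filtration.natural x hx k]) ω ∂μ :=
        (integral_condExp ((Filtration.natural x hx).le k)).symm
    _ ≤ ∫ _, σ ^ 2 ∂μ :=
        integral_mono_ae integrable_condExp (integrable_const _) (h.condVar k hk)
    _ = σ ^ 2 := by simp

theorem mainTheorem2_general {E : Type*} [NormedAddCommGroup E] [InnerProductSpace ℝ E]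
    [ProperSpace E] {Ω : Type*} {mΩ : MeasurableSpace Ω} {μ : Measure Ω} [IsFiniteMeasure μ]
    {f : E → ℝ} (hf : Differentiable ℝ f) (hbdd : ∃ B, ∀ y, B ≤ f y)
    {L : ℝ≥0} (hLip : LipschitzWith L (∇ f))
    (hloj : ∀ z, ∇ f z = 0 → ∃ θ < 1, HasLojasiewiczExponent f z θ)
    {lam ν : ℝ} (hlam0 : 0 ≤ lam) (hlam1 : lam < 1)
    {α : ℕ → ℝ} (hα : ∀ k, 1 ≤ k → 0 < α k)
    (hαsum : Tendsto (fun n : ℕ => ∑ k ∈ Finset.Icc 1 n, α k) atTop atTop)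
    {r : ℝ} (hr : 1 / 2 < r)
    (hαsq : Summable fun k : ℕ =>
      α (k + 1) ^ 2 * (∑ i ∈ Finset.Icc 1 (k + 1), α i) ^ (2 * r))
    {ℱ : Filtration ℕ mΩ} {e x : ℕ → Ω → E} (hxℱ : StronglyAdapted ℱ x)
    (hx : ∀ ω, IsMomentumPath f α lam ν (fun k => e k ω) fun k => x k ω)
    (he : ∀ k, 1 ≤ k → MemLp (e k) 2 μ) (hmean : ∀ k, 1 ≤ k → μ[e k | ℱ k] =ᵐ[μ] 0)
    {C : ℝ} (hC : ∀ k, 1 ≤ k → ∫ ω, ‖e k ω‖ ^ 2 ∂μ ≤ C) :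
    ∀ᵐ ω ∂μ, Tendsto (fun k => ‖x k ω‖) atTop atTop ∨
      ∃ z, ∇ f z = 0 ∧ Tendsto (fun k => x k ω) atTop (𝓝 z) := by
  obtain ⟨τ, δ, hτδ⟩ := exists_isAdmissibleBlockSize (L := L) (ν := ν) hlam0 hlam1
  obtain ⟨m, hm⟩ := exists_isBlockPartition (fun k hk => (hα k hk).le) hαsum
    (tendsto_stepSize_zero hα (by linarith) hαsq) hτδ.length_pos hτδ.step_pos
  have hmart : IsMartingaleDifferenceFrom ℱ 1 e μ :=
    ⟨he, fun k hk => stronglyMeasurable_error hxℱ hx hLip.continuous hk (hα k hk).ne', hmean⟩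
  filter_upwards [hm.ae_summable_rpow_mul_maxNormPartialSum_sq hτδ.length_pos hα (by linarith)
    hαsq hmart hC] with ω hω
  exact hτδ.tendsto_norm_atTop_or_tendsto hm (hx ω) hf hbdd hLip hloj
    (fun j i hi => norm_sum_range_le_maxNormPartialSum _ hi) (by linarith) hω

theorem mainTheorem2 {d : ℕ} {Ω : Type*} [MeasurableSpace Ω] (μ : Measure Ω)
    [IsProbabilityMeasure μ]
    (f : EuclideanSpace ℝ (Fin d) → ℝ) (hf : SmoothBoundedBelow f)
    (hloj : ∀ xs ∈ critSet f, LojasiewiczAt f xs)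
    (lam ν : ℝ) (hlam0 : 0 ≤ lam) (hlam1 : lam < 1) (hν : 0 ≤ ν)
    (α : ℕ → ℝ) (hαpos : ∀ k, 1 ≤ k → 0 < α k)
    (hαmono : ∀ k, 1 ≤ k → α (k + 1) ≤ α k)
    (hαsum : Tendsto (fun n : ℕ => ∑ k ∈ Finset.Icc 1 n, α k) atTop atTop)
    (r : ℝ) (hr : 1 / 2 < r)
    (hαsq : Summable fun k : ℕ =>
      α (k + 1) ^ 2 * (∑ i ∈ Finset.Icc 1 (k + 1), α i) ^ (2 * r))
    (x₀ : EuclideanSpace ℝ (Fin d)) (e x : ℕ → Ω → EuclideanSpace ℝ (Fin d))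
    (hx : ∀ k, StronglyMeasurable (x k))
    (hsgdm : IsSGDM f α lam ν x₀ e x)
    (σ : ℝ) (hnoise : NoiseAssumption μ x hx e σ) :
    ∀ᵐ ω ∂μ, Tendsto (fun k => ‖x k ω‖) atTop atTop ∨
      ∃ xs ∈ critSet f, Tendsto (fun k => x k ω) atTop (𝓝 xs) := by
  obtain ⟨L, -, hLip⟩ := hf.lipschitz
  refine mainTheorem2_general hf.differentiable hf.bddBelow hLip (fun z hz =>
    (hloj z hz).exists_hasLojasiewiczExponent (hf.differentiable z).continuousAt) hlam0 hlam1 hαpos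
    hαsum hr hαsq (Filtration.stronglyAdapted_natural hx) (fun ω k hk => hsgdm.step k hk ω)
    hnoise.memLp hnoise.condMean fun k hk => hnoise.integral_norm_sq_le hk
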